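/- Fix $p\in(\tfrac14,\tfrac13]$, put $\sigma=\sqrt{4p-1}$ and identify $\mathbb R^2$ with $\mathbb C$. Let $V=\{z\in\mathbb C: |2\,\mathrm{Re}\,z|+|2\,\mathrm{Im}\,z|/\sigma\le 1\}$, and for $b\in\{0,1\}$, $\varepsilon_b=(-1)^b$, let $$\phi_{(0,b)}(z)=pz-\tfrac{1-p}{2},\qquad \phi_{(1,b)}(z)=\tfrac{(1-2p)+i\varepsilon_b\sigma}{2}\,z+\tfrac{(2p-1)+i\varepsilon_b\sigma}{4},$$ $$\phi_{(2,b)}(z)=\tfrac{(1-2p)-i\varepsilon_b\sigma}{2}\,z+\tfrac{(1-2p)+i\varepsilon_b\sigma}{4},\qquad \phi_{(3,b)}(z)=pz+\tfrac{1-p}{2}.$$ Let $\mathbb S=\prod_{k\ge0}\{0,1\}^{4^k}$. For $\mathbf s=((s_k(0),\dots,s_k(4^k-1)))_{k\ge0}\in\mathbb S$ and $\mathbf u=(u_k)_{k\ge1}\in\{0,1,2,3\}^{\mathbb N}$ put $\omega_k=\bigl(u_k,\,s_{k-1}(\sum_{j=1}^{k-1}u_j4^{k-1-j})\bigr)$ for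 $k\ge1$, and let $\pi_{\mathbf s}(\mathbf u)$ be the unique point of $\bigcap_{k\ge1}\phi_{\omega_1}\circ\cdots\circ\phi_{\omega_k}(V)$. The generalised $p$-Koch curve of $\mathbf s$ is $\mathcal C(\mathbf s)=\{\pi_{\mathbf s}(\mathbf u):\mathbf u\in\{0,1,2,3\}^{\mathbb N}\}$, parameterised by $\rho_{\mathbf s}(x)=\pi_{\mathbf s}(\mathbf u)$, where $x=\sum_{k\ge1}u_k4^{-k}\in[0,1]$. With $f_1(z)=-\tfrac12(1+i\sqrt3)z+\tfrac14(1-i\sqrt3)$ and $f_2(z)=-\tfrac12(1-i\sqrt3)z-\tfrac14(1+i\sqrt3)$, the generalised $p$-Koch snowflake of $\mathbf s,\mathbf t,\mathbf r\in\mathbb S$ is $$\mathcal F(\mathbf s,\mathbf t,\mathbf r)=\mathcal C(\mathbf s)\cup f_1(\mathcal C(\mathbf t))\cup f_2(\mathcal C(\mathbf r)).$$ It is traversed counter-clockwise by the closed path $\gamma$ on $[0,1]$ with $\gamma(x)=\rho_{\mathbf s}(1-3x)$ for $0\le x<\tfrac13$, $\gamma(x)=f_2(\rho_{\mathbf r}(2-3x))$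 for $\tfrac13\le x<\tfrac23$, and $\gamma(x)=f_1(\rho_{\mathbf t}(3-3x))$ for $\tfrac23\le x\le1$. The region enclosed by $\mathcal F(\mathbf s,\mathbf t,\mathbf r)$ is the set of points $z\notin\mathcal F(\mathbf s,\mathbf t,\mathbf r)$ about which $\gamma$ has winding number $1$, and the enclosed area is the Lebesgue measure of this region. Let $y_p$ be the area enclosed by the $p$-Koch snowflake (all entries of $\mathbf s,\mathbf t,\mathbf r$ equal to $0$), and let $x_p$ be the area enclosed by the $p$-Koch anti-snowflake (all entries equal to $1$). **Theorem.** For every $p\in(\tfrac14,\tfrac13]$, $$x_p=\frac{\sqrt3}{4}-\frac34\cdot\frac{\sqrt{4p-1}}{1+2p},\qquad y_p=\frac{\sqrt3}{4}+\frac34\cdot\frac{\sqrt{4p-1}}{1+2p},$$ and for every $y\in[x_p,y_p]$ there exists a generalised $p$-Koch snowflake $\mathcal F(\mathbf s,\mathbf t,\mathbf r)$, $\mathbf s,\mathbf t,\mathbf r\in\mathbb S$, whose enclosed area equals $y$. -/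

import Mathlib

/-! Throughout, the Euclidean plane `ℝ²` is identified with `ℂ` through `(x, y) ↦ x + y * I`, so that
the matrix with rows `(a, -b)` and `(b, a)` acts as multiplication by `a + b * I`. -/

namespace Koch

/-- The closed filled-in rhombus `V` with vertices `(±1/2, 0)` and `(0, ±√(4p-1)/2)`. -/
def rhombus (p : ℝ) : Set ℂ :=
  {z | |2 * z.re| + |2 * z.im / Real.sqrt (4 * p - 1)| ≤ 1}

/-- The contractions `φ_(a,b)` for `a ∈ {0,1,2,3}` and `b ∈ {0,1}`. Replacing a segment by its
four images under `φ_(0,b), …, φ_(3,b)` erects an isosceles triangle on its middle part, pointing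
upwards if `b = 0` and downwards if `b = 1`. -/
noncomputable def φ (p : ℝ) : Fin 4 → Fin 2 → ℂ → ℂ
  | 0, _, z => p * z - (1 - p) / 2
  | 1, 0, z => ((1 - 2 * p) + Real.sqrt (4 * p - 1) * Complex.I) / 2 * z
      + ((2 * p - 1) + Real.sqrt (4 * p - 1) * Complex.I) / 4
  | 1, 1, z => ((1 - 2 * p) - Real.sqrt (4 * p - 1) * Complex.I) / 2 * z
      + ((2 * p - 1) - Real.sqrt (4 * p - 1) * Complex.I) / 4
  | 2, 0, z => ((1 - 2 * p) - Real.sqrt (4 * p - 1) * Complex.I) / 2 * z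
      + ((1 - 2 * p) + Real.sqrt (4 * p - 1) * Complex.I) / 4
  | 2, 1, z => ((1 - 2 * p) + Real.sqrt (4 * p - 1) * Complex.I) / 2 * z
      + ((1 - 2 * p) - Real.sqrt (4 * p - 1) * Complex.I) / 4
  | 3, _, z => p * z + (1 - p) / 2

/-- The set `𝕊 = ∏_{k ≥ 0} {0,1}^(4^k)` of sequences of orientation choices. -/
abbrev Choices : Type := (k : ℕ) → Fin (4 ^ k) → Fin 2

/-- The index `∑_{j < k} u_j 4^(k-1-j)` of the segment of generation `k` reached by the
digits `u_0, …, u_{k-1}`, see `address_val`. -/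
def address (u : ℕ → Fin 4) : (k : ℕ) → Fin (4 ^ k)
  | 0 => ⟨0, by norm_num⟩
  | k + 1 => ⟨4 * (address u k).val + (u k).val, by
      have h1 := (address u k).isLt
      have h2 := (u k).isLt
      rw [pow_succ]
      omega⟩

theorem address_val (u : ℕ → Fin 4) (k : ℕ) :
    (address u k).val = ∑ j ∈ Finset.range k, (u j).val * 4 ^ (k - 1 - j) := by
  induction k with
  | zero => simp [address]
  | succ k ih =>
    have h : (address u (k + 1)).val = 4 * (address u k).val + (u k).val := rfl
    rw [h, ih, Finset.sum_range_succ, Finset.mul_sum]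
    simp only [Nat.add_sub_cancel, Nat.sub_self, pow_zero, mul_one]
    congr 1
    refine Finset.sum_congr rfl fun j hj => ?_
    have hjk : k - j = (k - 1 - j) + 1 := by
      have := Finset.mem_range.mp hj
      omega
    rw [hjk, pow_succ]
    ring

/-- The composition `φ_{ω_1} ∘ ⋯ ∘ φ_{ω_k}`, where `ω_{j+1} = (u_j, s_j(address u j))`; the digits
`u_0, u_1, …` are numbered from zero. -/
noncomputable def compφ (p : ℝ) (s : Choices) (u : ℕ → Fin 4) : ℕ → ℂ → ℂ
  | 0 => id
  | k + 1 => compφ p s u k ∘ φ p (u k) (s k (address u k))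

/-- The intersection `⋂_{k ≥ 1} φ_{ω_1} ∘ ⋯ ∘ φ_{ω_k} (V)`; it has exactly one element. -/
def limitSet (p : ℝ) (s : Choices) (u : ℕ → Fin 4) : Set ℂ :=
  ⋂ k : ℕ, compφ p s u (k + 1) '' rhombus p

/-- The generalised `p`-Koch curve of the choices `s`, joining `-1/2` to `1/2`. -/
def curve (p : ℝ) (s : Choices) : Set ℂ :=
  ⋃ u : ℕ → Fin 4, limitSet p s u

/-- The isometry `f₁` carrying the top side `[-1/2, 1/2]` of the triangle to its right side. -/
noncomputable def f₁ (z : ℂ) : ℂ :=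
  -(1 / 2) * (1 + Real.sqrt 3 * Complex.I) * z + (1 - Real.sqrt 3 * Complex.I) / 4

/-- The isometry `f₂` carrying the top side `[-1/2, 1/2]` of the triangle to its left side. -/
noncomputable def f₂ (z : ℂ) : ℂ :=
  -(1 / 2) * (1 - Real.sqrt 3 * Complex.I) * z - (1 + Real.sqrt 3 * Complex.I) / 4

/-- The generalised `p`-Koch snowflake `𝓕(s, t, r)`. -/
def snowflake (p : ℝ) (s t r : Choices) : Set ℂ :=
  curve p s ∪ f₁ '' curve p t ∪ f₂ '' curve p r

/-- Base 4 digits of `t ∈ [0, 1]` (all of them equal to `3` for `t = 1`). -/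
noncomputable def baseFour (t : ℝ) : ℕ → Fin 4 :=
  if t < 1 then Real.digits t 4 else fun _ => 3

theorem ofDigits_baseFour {t : ℝ} (ht : t ∈ Set.Icc (0 : ℝ) 1) :
    Real.ofDigits (baseFour t) = t := by
  unfold baseFour
  split_ifs with h
  · exact Real.ofDigits_digits (by norm_num) ⟨ht.1, h⟩
  · have h1 : t = 1 := le_antisymm ht.2 (not_lt.mp h)
    rw [h1]
    exact Real.ofDigits_const_last_eq_one 3

/-- The parameterisation `ρ_s` on `[0, 1]` of the generalised `p`-Koch curve: `ρ_s(t)` is the sole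
element of the intersection belonging to the base 4 digits of `t`. -/
noncomputable def curveParam (p : ℝ) (s : Choices) (t : ℝ) : ℂ :=
  Classical.epsilon fun z => z ∈ limitSet p s (baseFour t)

/-- The counter-clockwise parameterisation `γ` on `[0, 1]` of the snowflake `𝓕(s, t, r)`. -/
noncomputable def snowflakeParam (p : ℝ) (s t r : Choices) (x : ℝ) : ℂ :=
  if x < 1 / 3 then curveParam p s (1 - 3 * x)
  else if x < 2 / 3 then f₂ (curveParam p r (2 - 3 * x))
  else f₁ (curveParam p t (3 - 3 * x))

/-- The closed path `γ` on `[0, 1]` avoids `z` and has winding number `n` about `z`: along a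
continuous branch `L` of `log (γ - z)`, the logarithm increases by `2πi n`. -/
def HasWindingNumber (γ : ℝ → ℂ) (z : ℂ) (n : ℤ) : Prop :=
  ∃ L : ℝ → ℂ, ContinuousOn L (Set.Icc 0 1) ∧
    (∀ x ∈ Set.Icc (0 : ℝ) 1, Complex.exp (L x) = γ x - z) ∧
    L 1 - L 0 = 2 * Real.pi * Complex.I * n

/-- The region enclosed by the snowflake `𝓕(s, t, r)`: the points off the snowflake about which it
winds exactly once when it is traversed counter-clockwise. It is the union of those components
of the complement on which the winding number is one. -/
def enclosedRegion (p : ℝ) (s t r : Choices) : Set ℂ :=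
  {z | z ∉ snowflake p s t r ∧ HasWindingNumber (snowflakeParam p s t r) z 1}

/-- The area (Lebesgue measure) of the region enclosed by the snowflake `𝓕(s, t, r)`. -/
noncomputable def enclosedArea (p : ℝ) (s t r : Choices) : ENNReal :=
  MeasureTheory.volume (enclosedRegion p s t r)

/-- The choices in which every triangle has orientation `b`. -/
def constChoices (b : Fin 2) : Choices := fun _ _ => b

/-- The area `y_p` enclosed by the `p`-Koch snowflake: all triangles point outwards. -/
noncomputable def snowflakeArea (p : ℝ) : ENNReal :=
  enclosedArea p (constChoices 0) (constChoices 0) (constChoices 0)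

/-- The area `x_p` enclosed by the `p`-Koch anti-snowflake: all triangles point inwards. -/
noncomputable def antiSnowflakeArea (p : ℝ) : ENNReal :=
  enclosedArea p (constChoices 1) (constChoices 1) (constChoices 1)

end Koch

/-! Let `V` be the rhombus of the construction. For `z` off a curve let the index of the curve at `z`
be the number of clockwise turns about `z` of the curve closed up by the segment from `1/2` to `-1/2`.
Replacing that segment by its four images adds to the index `±1` on the triangle erected on it, and
what remains are the indices of four similar smaller curves. Truncated after `n` steps this
recursion defines `index`; it gives the true index at almost every point not covered by the `4 ^ n`
rhombi of generation `n` (`ae_hasLogIncrement`), because a curve confined to a convex set not containing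
`z` has the same increment of `log (γ - z)` as the segment joining its ends. The step of the recursion
is the fact that the angles subtended by the sides of a triangle add up to a full turn from inside
and to zero from outside (`log_add_log_add_log`).

The index vanishes off `V`, is `0` or `1` in the upper half of `V`, and `0` or `-1` in the lower half
(`index_range`): for `p ≤ 1/3` the four rhombi of the next generation are disjoint, and those on the two
sides of the triangle have exactly their inner halves in it. By the same argument the winding number of
the snowflake, which is the indicator of the equilateral triangle plus the indices of the three sides,
is `0` or `1` almost everywhere (`wind_range`). So the area of the set where it is `1` is its integral,
a sum of signed areas of triangles; as the rhombi of generation `n` have total area at most a constant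
times `(4 p ^ 2) ^ n`, the enclosed area is the sum of the resulting series (`enclosedArea_eq`).

For constant choices the series is geometric. In general, generation `k` of the three sides has
`3 * 4 ^ k` triangles whose size is proportional to `p ^ (2 k)`, and turning some of them downwards lowers
the area by twice their size. Since `16 p ^ 2 ≥ 1`, each triangle is at most as large as all those of later
generations together, so a greedy choice realises every value in between (`exists_greedy`). One side
would not suffice for this; it is the three triangles in generation `0` that make room. -/

namespace Koch

open MeasureTheory Set Filter Topology

/-! ### Increments of the logarithm along a path -/

/-- The path `γ` on `[a, b]` avoids `z`, and a continuous branch of `log (γ - z)` along it increases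
by `w`. -/
def HasLogIncrement (γ : ℝ → ℂ) (z : ℂ) (a b : ℝ) (w : ℂ) : Prop :=
  ∃ L : ℝ → ℂ, ContinuousOn L (Icc a b) ∧ (∀ x ∈ Icc a b, Complex.exp (L x) = γ x - z) ∧
    L b - L a = w

theorem HasLogIncrement.trans {γ : ℝ → ℂ} {z w w' : ℂ} {a b c : ℝ} (hab : a ≤ b) (hbc : b ≤ c)
    (h : HasLogIncrement γ z a b w) (h' : HasLogIncrement γ z b c w') :
    HasLogIncrement γ z a c (w + w') := by
  obtain ⟨L, hL, hLe, rfl⟩ := h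
  obtain ⟨M, hM, hMe, rfl⟩ := h'
  have hb : Complex.exp (L b - M b) = 1 := by
    rw [Complex.exp_sub, hLe b ⟨hab, le_rfl⟩, hMe b ⟨le_rfl, hbc⟩, div_self]
    rw [← hMe b ⟨le_rfl, hbc⟩]
    exact Complex.exp_ne_zero _
  set N : ℝ → ℂ := fun x => if x ≤ b then L x else M x + (L b - M b) with hN
  have h1 : ∀ x ∈ Icc a b, N x = L x := fun x hx => if_pos hx.2
  have h2 : ∀ x ∈ Icc b c, N x = M x + (L b - M b) := by
    intro x hx
    rcases hx.1.eq_or_lt with rfl | hlt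
    · simp [hN]
    · exact if_neg (not_le.mpr hlt)
  refine ⟨N, ?_, ?_, ?_⟩
  · rw [← Icc_union_Icc_eq_Icc hab hbc]
    exact (hL.congr h1).union_of_isClosed ((hM.add continuousOn_const).congr h2)
      isClosed_Icc isClosed_Icc
  · intro x hx
    rcases le_total x b with hxb | hxb
    · rw [h1 x ⟨hx.1, hxb⟩, hLe x ⟨hx.1, hxb⟩]
    · rw [h2 x ⟨hxb, hx.2⟩, Complex.exp_add, hb, mul_one, hMe x ⟨hxb, hx.2⟩]
  · rw [h1 a ⟨le_rfl, hab⟩, h2 c ⟨hbc, le_rfl⟩]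
    ring

/-- A similarity of the plane and an increasing change of parameter keep the increment. -/
theorem HasLogIncrement.transport {γ γ' : ℝ → ℂ} {z z' m w : ℂ} {a b c d : ℝ} {f : ℝ → ℝ}
    (h : HasLogIncrement γ z c d w) (hm : m ≠ 0) (hf : Continuous f)
    (hmaps : MapsTo f (Icc a b) (Icc c d)) (ha : f a = c) (hb : f b = d)
    (hγ : ∀ x ∈ Icc a b, γ' x - z' = m * (γ (f x) - z)) : HasLogIncrement γ' z' a b w := by
  obtain ⟨L, hL, hLe, rfl⟩ := h
  refine ⟨fun x => L (f x) + Complex.log m, (hL.comp hf.continuousOn hmaps).add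
    continuousOn_const, fun x hx => ?_, ?_⟩
  · rw [Complex.exp_add, hLe _ (hmaps hx), Complex.exp_log hm, hγ x hx, mul_comm]
  · simp only [ha, hb]
    ring

/-- A similarity of the plane and a decreasing change of parameter negate the increment. -/
theorem HasLogIncrement.transport_neg {γ γ' : ℝ → ℂ} {z z' m w : ℂ} {a b c d : ℝ} {f : ℝ → ℝ}
    (h : HasLogIncrement γ z c d w) (hm : m ≠ 0) (hf : Continuous f)
    (hmaps : MapsTo f (Icc a b) (Icc c d)) (ha : f a = d) (hb : f b = c)
    (hγ : ∀ x ∈ Icc a b, γ' x - z' = m * (γ (f x) - z)) : HasLogIncrement γ' z' a b (-w) := by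
  obtain ⟨L, hL, hLe, rfl⟩ := h
  refine ⟨fun x => L (f x) + Complex.log m, (hL.comp hf.continuousOn hmaps).add
    continuousOn_const, fun x hx => ?_, ?_⟩
  · rw [Complex.exp_add, hLe _ (hmaps hx), Complex.exp_log hm, hγ x hx, mul_comm]
  · simp only [ha, hb]
    ring

/-- A path in a closed convex set `V` has, about a point off `V`, the increment of the segment
joining its ends. -/
theorem HasLogIncrement.of_convex {γ : ℝ → ℂ} {z : ℂ} {V : Set ℂ} {a b : ℝ} (hab : a ≤ b)
    (hV : Convex ℝ V) (hz : z ∉ V) (hγ : ContinuousOn γ (Icc a b)) (hmem : MapsTo γ (Icc a b) V) :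
    HasLogIncrement γ z a b (Complex.log ((γ b - z) / (γ a - z))) := by
  have ha : γ a ∈ V := hmem ⟨le_rfl, hab⟩
  have ha0 : γ a - z ≠ 0 := fun h => hz (by rwa [← sub_eq_zero.mp h])
  have hslit : ∀ x ∈ Icc a b, (γ x - z) / (γ a - z) ∈ Complex.slitPlane := by
    intro x hx
    by_contra hns
    rw [Complex.mem_slitPlane_iff, not_or, not_lt, not_not] at hns
    set q := (γ x - z) / (γ a - z) with hq
    have hqr : q = ((q.re : ℝ) : ℂ) := Complex.ext (by simp) (by simp [hns.2])
    have h1 : γ x - z = q * (γ a - z) := by rw [hq, div_mul_cancel₀ _ ha0]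
    -- A nonpositive ratio would put `z` between two points of `V`.
    have hpos : 0 < 1 - q.re := by linarith [hns.1]
    apply hz
    have hcomb := hV (hmem hx) ha (a := 1 / (1 - q.re)) (b := -q.re / (1 - q.re))
      (by positivity) (div_nonneg (by linarith [hns.1]) hpos.le) (by field_simp; ring)
    convert hcomb using 1
    have hne : (1 - (q.re : ℂ)) ≠ 0 := by exact_mod_cast hpos.ne'
    rw [hqr] at h1
    simp only [Complex.real_smul]
    push_cast
    field_simp
    linear_combination -h1
  refine ⟨fun x => Complex.log ((γ x - z) / (γ a - z)) + Complex.log (γ a - z), ?_, ?_, ?_⟩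
  · exact (((hγ.sub continuousOn_const).div_const _).clog hslit).add continuousOn_const
  · intro x hx
    rw [Complex.exp_add, Complex.exp_log (Complex.slitPlane_ne_zero (hslit x hx)),
      Complex.exp_log ha0, div_mul_cancel₀ _ ha0]
  · simp [div_self ha0]

/-- The winding number is unique. -/
theorem HasWindingNumber.unique {γ : ℝ → ℂ} {z : ℂ} {m n : ℤ} (hm : HasWindingNumber γ z m)
    (hn : HasWindingNumber γ z n) : m = n := by
  obtain ⟨L, hL, hLe, hLd⟩ := hm
  obtain ⟨M, hM, hMe, hMd⟩ := hn
  have hpi : (2 * Real.pi * Complex.I : ℂ) ≠ 0 := by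
    simp [Real.pi_ne_zero]
  have hex : ∀ x : ℝ, ∃ k : ℤ, x ∈ Icc (0 : ℝ) 1 →
      L x = M x + k * (2 * Real.pi * Complex.I) := by
    intro x
    by_cases hx : x ∈ Icc (0 : ℝ) 1
    · obtain ⟨k, hk⟩ := Complex.exp_eq_exp_iff_exists_int.mp ((hLe x hx).trans (hMe x hx).symm)
      exact ⟨k, fun _ => hk⟩
    · exact ⟨0, fun h => absurd h hx⟩
  choose k hk using hex
  have hcont : ContinuousOn k (Icc 0 1) := by
    rw [Int.isClosedEmbedding_coe_real.isInducing.continuousOn_iff]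
    have h1 : ContinuousOn (fun x => ((L x - M x) / (2 * Real.pi * Complex.I)).re) (Icc 0 1) :=
      Complex.continuous_re.comp_continuousOn ((hL.sub hM).div_const _)
    refine h1.congr fun x hx => ?_
    have : (L x - M x) / (2 * Real.pi * Complex.I) = ((k x : ℝ) : ℂ) := by
      rw [hk x hx, add_sub_cancel_left, mul_div_cancel_right₀ _ hpi]
      simp
    simp only [this, Function.comp_apply, Complex.ofReal_re]
  have h01 : k 0 = k 1 := isPreconnected_Icc.constant hcont (by simp) (by simp)
  have h0 := hk 0 (by simp)
  have h1 := hk 1 (by simp)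
  rw [h01] at h0
  have h2 : (2 * Real.pi * Complex.I : ℂ) * m = 2 * Real.pi * Complex.I * n := by
    rw [← hLd, ← hMd, h0, h1]
    ring
  exact_mod_cast mul_left_cancel₀ hpi h2

/-! ### Angles subtended by the sides of a triangle -/

/-- If `x + y + t` is a full number of turns, where `x`, `y`, `t` are logarithms with imaginary
parts in `(-π, π)`, then the number of turns can be read off from the signs of the imaginary
parts. -/
theorem log_add_log_add_log {x y t : ℂ} (hx : x.im ≠ 0) (hy : y.im ≠ 0) (ht : t.im ≠ 0)
    (h : x * y * t = 1) :
    Complex.log x + Complex.log y + Complex.log t = 2 * Real.pi * Complex.I *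
      ((if 0 < x.im ∧ 0 < y.im ∧ 0 < t.im then 1 else 0 : ℤ) -
        (if x.im < 0 ∧ y.im < 0 ∧ t.im < 0 then 1 else 0 : ℤ) : ℤ) := by
  have ne0 : ∀ {c : ℂ}, c.im ≠ 0 → c ≠ 0 := fun hc h0 => hc (by simp [h0])
  have key : ∀ {c : ℂ}, c.im ≠ 0 → (0 < c.im → 0 < (Complex.log c).im ∧
      (Complex.log c).im < Real.pi) ∧ (c.im < 0 → (Complex.log c).im < 0 ∧
      -Real.pi < (Complex.log c).im) := by
    intro c hc
    rw [Complex.log_im]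
    refine ⟨fun hpos => ⟨?_, ?_⟩, fun hneg => ⟨Complex.arg_neg_iff.mpr hneg,
      Complex.neg_pi_lt_arg c⟩⟩
    · refine lt_of_le_of_ne (Complex.arg_nonneg_iff.mpr hpos.le) fun h0 => hc ?_
      exact (Complex.arg_eq_zero_iff.mp h0.symm).2
    · exact Complex.arg_lt_pi_iff.mpr (Or.inr hc)
  have hexp : Complex.exp (Complex.log x + Complex.log y + Complex.log t) = 1 := by
    rw [Complex.exp_add, Complex.exp_add, Complex.exp_log (ne0 hx), Complex.exp_log (ne0 hy),
      Complex.exp_log (ne0 ht), h]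
  obtain ⟨n, hn⟩ := Complex.exp_eq_one_iff.mp hexp
  have him : (Complex.log x).im + (Complex.log y).im + (Complex.log t).im
      = n * (2 * Real.pi) := by
    have := congrArg Complex.im hn
    simpa using this
  have hpi := Real.pi_pos
  -- The sum of the angles determines `n` through `|n * 2π - (expected value)| < 2π`.
  have bound : ∀ {lo hi : ℤ}, (lo : ℝ) * Real.pi < n * (2 * Real.pi) →
      (n : ℝ) * (2 * Real.pi) < hi * Real.pi → lo < 2 * n ∧ 2 * n < hi := by
    intro lo hi h1 h2
    have h1' : (lo : ℝ) < 2 * n := by nlinarith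
    have h2' : (2 * n : ℝ) < hi := by nlinarith
    exact ⟨by exact_mod_cast h1', by exact_mod_cast h2'⟩
  have hres : n = (if 0 < x.im ∧ 0 < y.im ∧ 0 < t.im then 1 else 0 : ℤ) -
        (if x.im < 0 ∧ y.im < 0 ∧ t.im < 0 then 1 else 0 : ℤ) := by
    have kx := key hx
    have ky := key hy
    have kt := key ht
    rcases lt_or_gt_of_ne hx with sx | sx <;> rcases lt_or_gt_of_ne hy with sy | sy <;>
      rcases lt_or_gt_of_ne ht with st | st <;>
      simp only [sx, sy, st, not_lt_of_gt sx, not_lt_of_gt sy, not_lt_of_gt st, true_imp_iff,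
        false_imp_iff, and_true, true_and, and_false, if_true, if_false] at kx ky kt ⊢
    · have := bound (lo := -3) (hi := 0) (by push_cast; linarith) (by push_cast; linarith)
      omega
    · have := bound (lo := -2) (hi := 1) (by push_cast; linarith) (by push_cast; linarith)
      omega
    · have := bound (lo := -2) (hi := 1) (by push_cast; linarith) (by push_cast; linarith)
      omega
    · have := bound (lo := -1) (hi := 2) (by push_cast; linarith) (by push_cast; linarith)
      omega
    · have := bound (lo := -2) (hi := 1) (by push_cast; linarith) (by push_cast; linarith)
      omega
    · have := bound (lo := -1) (hi := 2) (by push_cast; linarith) (by push_cast; linarith)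
      omega
    · have := bound (lo := -1) (hi := 2) (by push_cast; linarith) (by push_cast; linarith)
      omega
    · have := bound (lo := 0) (hi := 3) (by push_cast; linarith) (by push_cast; linarith)
      omega
  rw [hn, ← hres]
  ring

theorem im_div_real (A B : ℝ) (z : ℂ) : ((B - z) / (A - z) : ℂ).im =
    (B - A) * z.im / Complex.normSq (A - z) := by
  rw [Complex.div_im]
  simp only [Complex.sub_re, Complex.sub_im, Complex.ofReal_re, Complex.ofReal_im]
  ring

theorem normSq_real_sub_pos (A : ℝ) {z : ℂ} (hz : z.im ≠ 0) : 0 < Complex.normSq (A - z) := by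
  rw [Complex.normSq_pos]
  intro h
  apply hz
  simpa using congrArg Complex.im h

theorem im_div_real_pos {A B : ℝ} (h : A < B) {z : ℂ} (hz : z.im ≠ 0) :
    0 < ((B - z) / (A - z) : ℂ).im ↔ 0 < z.im := by
  rw [im_div_real, div_pos_iff_of_pos_right (normSq_real_sub_pos A hz),
    mul_pos_iff_of_pos_left (sub_pos.mpr h)]

theorem im_div_real_neg {A B : ℝ} (h : A < B) {z : ℂ} (hz : z.im ≠ 0) :
    ((B - z) / (A - z) : ℂ).im < 0 ↔ z.im < 0 := by
  rw [im_div_real, div_lt_iff₀ (normSq_real_sub_pos A hz), zero_mul,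
    ← neg_pos, ← mul_neg, mul_pos_iff_of_pos_left (sub_pos.mpr h), neg_pos]

theorem im_div_real_ne {A B : ℝ} (h : A < B) {z : ℂ} (hz : z.im ≠ 0) :
    ((B - z) / (A - z) : ℂ).im ≠ 0 := by
  rw [im_div_real]
  exact div_ne_zero (mul_ne_zero (sub_pos.mpr h).ne' hz) (normSq_real_sub_pos A hz).ne'

theorem real_sub_ne (A : ℝ) {z : ℂ} (hz : z.im ≠ 0) : (A - z : ℂ) ≠ 0 :=
  Complex.normSq_pos.mp (normSq_real_sub_pos A hz)

theorem log_inv_of_im_ne {c : ℂ} (hc : c.im ≠ 0) : Complex.log c⁻¹ = -Complex.log c :=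
  Complex.log_inv c fun h => hc (Complex.arg_eq_pi_iff.mp h).2

theorem inv_im_pos {c : ℂ} (hc : c.im ≠ 0) : 0 < c⁻¹.im ↔ c.im < 0 := by
  have h : 0 < Complex.normSq c := Complex.normSq_pos.mpr fun h0 => hc (by simp [h0])
  rw [Complex.inv_im, div_pos_iff_of_pos_right h, neg_pos]

theorem inv_im_neg {c : ℂ} (hc : c.im ≠ 0) : c⁻¹.im < 0 ↔ 0 < c.im := by
  have h : 0 < Complex.normSq c := Complex.normSq_pos.mpr fun h0 => hc (by simp [h0])
  rw [Complex.inv_im, div_lt_iff₀ h, zero_mul, neg_lt_zero]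

theorem inv_im_ne {c : ℂ} (hc : c.im ≠ 0) : c⁻¹.im ≠ 0 := by
  rcases lt_or_gt_of_ne hc with h | h
  · exact ((inv_im_pos hc).mpr h).ne'
  · exact ((inv_im_neg hc).mpr h).ne

/-- Consecutive segments of the real line subtend angles that add up. -/
theorem log_div_add_log_div {A B C : ℝ} (hAB : A < B) (hBC : B < C) {z : ℂ} (hz : z.im ≠ 0) :
    Complex.log ((B - z) / (A - z)) + Complex.log ((C - z) / (B - z)) =
      Complex.log ((C - z) / (A - z)) := by
  have hc := im_div_real_ne (hAB.trans hBC) hz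
  have h := log_add_log_add_log (im_div_real_ne hAB hz) (im_div_real_ne hBC hz) (inv_im_ne hc) (by
    have h1 := real_sub_ne A hz
    have h2 := real_sub_ne B hz
    have h3 := real_sub_ne C hz
    field_simp)
  rw [if_neg, if_neg, log_inv_of_im_ne hc] at h
  · linear_combination h
  · rw [inv_im_neg hc, im_div_real_neg hAB hz, im_div_real_pos (hAB.trans hBC) hz]
    rintro ⟨h1, -, h2⟩
    linarith
  · rw [inv_im_pos hc, im_div_real_pos hAB hz, im_div_real_neg (hAB.trans hBC) hz]
    rintro ⟨h1, -, h2⟩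
    linarith

/-- The oriented angle (times `I`, up to a real part) under which the segment `[-1/2, 1/2]` is seen
from `w`. -/
noncomputable def segLog (w : ℂ) : ℂ :=
  Complex.log ((((1 / 2 : ℝ) : ℂ) - w) / (((-1 / 2 : ℝ) : ℂ) - w))

/-! ### Areas -/

theorem map_mul_volume {m : ℂ} (hm : m ≠ 0) :
    Measure.map (fun z : ℂ => m * z) volume = ENNReal.ofReal (‖m‖ ^ 2)⁻¹ • (volume : Measure ℂ) := by
  have hdet : LinearMap.det (LinearMap.mul ℝ ℂ m) = ‖m‖ ^ 2 := by
    change LinearMap.det (Algebra.lmul ℝ ℂ m : ℂ →ₗ[ℝ] ℂ) = ‖m‖ ^ 2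
    rw [← Algebra.norm_apply, Algebra.norm_complex_apply, Complex.normSq_eq_norm_sq]
  have hpos : 0 < ‖m‖ ^ 2 := by positivity
  have h := Measure.map_linearMap_addHaar_eq_smul_addHaar (μ := (volume : Measure ℂ))
    (f := LinearMap.mul ℝ ℂ m) (by rw [hdet]; exact hpos.ne')
  rw [hdet, abs_of_pos (inv_pos.mpr hpos)] at h
  exact h

theorem map_affine_volume {m : ℂ} (hm : m ≠ 0) (d : ℂ) :
    Measure.map (fun z : ℂ => m * z + d) volume =
      ENNReal.ofReal (‖m‖ ^ 2)⁻¹ • (volume : Measure ℂ) := by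
  have h : (fun z : ℂ => m * z + d) = (fun z => z + d) ∘ fun z => m * z := rfl
  rw [h, ← Measure.map_map (by fun_prop) (by fun_prop), map_mul_volume hm, Measure.map_smul,
    map_add_right_eq_self]

theorem sub_div_eq_affine (m d : ℂ) :
    (fun z : ℂ => (z - d) / m) = fun z => m⁻¹ * z + (-d / m) := by
  funext z
  ring

theorem map_sub_div_volume {m : ℂ} (hm : m ≠ 0) (d : ℂ) :
    Measure.map (fun z : ℂ => (z - d) / m) volume =
      ENNReal.ofReal (‖m‖ ^ 2) • (volume : Measure ℂ) := by
  rw [sub_div_eq_affine, map_affine_volume (inv_ne_zero hm)]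
  simp

theorem ae_sub_div {m : ℂ} (hm : m ≠ 0) (d : ℂ) {P : ℂ → Prop} (h : ∀ᵐ w, P w) :
    ∀ᵐ z : ℂ, P ((z - d) / m) := by
  have hq : Measure.QuasiMeasurePreserving (fun z : ℂ => (z - d) / m) volume volume :=
    ⟨by fun_prop, by rw [map_sub_div_volume hm]; exact Measure.smul_absolutelyContinuous⟩
  exact hq.ae h

theorem measurableEmbedding_sub_div {m : ℂ} (hm : m ≠ 0) (d : ℂ) :
    MeasurableEmbedding fun z : ℂ => (z - d) / m := by
  have h1 : MeasurableEmbedding fun z : ℂ => z - d := measurableEmbedding_subRight d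
  have h2 : MeasurableEmbedding fun z : ℂ => m⁻¹ * z :=
    measurableEmbedding_mulLeft₀ (inv_ne_zero hm)
  convert h2.comp h1 using 1
  funext z
  simp only [Function.comp_apply]
  ring

theorem integral_comp_sub_div {m : ℂ} (hm : m ≠ 0) (d : ℂ) (f : ℂ → ℝ) :
    ∫ z, f ((z - d) / m) = ‖m‖ ^ 2 * ∫ w, f w := by
  rw [← (measurableEmbedding_sub_div hm d).integral_map f, map_sub_div_volume hm,
    integral_smul_measure, ENNReal.toReal_ofReal (by positivity), smul_eq_mul]

theorem integrable_comp_sub_div {m : ℂ} (hm : m ≠ 0) (d : ℂ) {f : ℂ → ℝ} (hf : Integrable f) :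
    Integrable fun z => f ((z - d) / m) := by
  rw [show (fun z => f ((z - d) / m)) = f ∘ fun z => (z - d) / m from rfl,
    ← (measurableEmbedding_sub_div hm d).integrable_map_iff, map_sub_div_volume hm]
  exact hf.smul_measure ENNReal.ofReal_ne_top

theorem volume_image_affine {m : ℂ} (hm : m ≠ 0) (d : ℂ) (S : Set ℂ) :
    volume ((fun z => m * z + d) '' S) = ENNReal.ofReal (‖m‖ ^ 2) * volume S := by
  have h : (fun z => m * z + d) '' S = (fun z : ℂ => (z - d) / m) ⁻¹' S := by
    ext z
    constructor
    · rintro ⟨w, hw, rfl⟩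
      simpa [hm] using hw
    · intro hz
      refine ⟨_, hz, ?_⟩
      simp only []
      field_simp
      ring
  rw [h, ← (measurableEmbedding_sub_div hm d).map_apply, map_sub_div_volume hm,
    Measure.smul_apply, smul_eq_mul]

theorem ae_im_ne_zero : ∀ᵐ z : ℂ, z.im ≠ 0 := by
  have h := Measure.addHaar_submodule (volume : Measure ℂ) (LinearMap.ker Complex.imLm) (by
    intro htop
    have : Complex.I ∈ LinearMap.ker Complex.imLm := by rw [htop]; trivial
    simp at this)
  rw [ae_iff]
  convert h using 2
  ext z
  simp

/-- The open isosceles triangle with base `[-w, w]` and apex `h * I`; it lies below its base if `h` is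
negative. -/
def tri (w h : ℝ) : Set ℂ := {z | 0 < z.im / h ∧ |z.re| / w + z.im / h < 1}

theorem measurableSet_tri (w h : ℝ) : MeasurableSet (tri w h) := by
  have h1 : MeasurableSet {z : ℂ | 0 < z.im / h} :=
    measurableSet_lt measurable_const (by fun_prop)
  have h2 : MeasurableSet {z : ℂ | |z.re| / w + z.im / h < 1} :=
    measurableSet_lt (by fun_prop) measurable_const
  exact h1.inter h2

theorem integral_abs_symm {w : ℝ} (hw : 0 < w) (h : ℝ) :
    ∫ x in Ioo (-w) w, h * (1 - |x| / w) = w * h := by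
  rw [← integral_Ioc_eq_integral_Ioo, ← intervalIntegral.integral_of_le (by linarith),
    ← intervalIntegral.integral_add_adjacent_intervals (b := 0)
      (Continuous.intervalIntegrable (by fun_prop) _ _)
      (Continuous.intervalIntegrable (by fun_prop) _ _)]
  have h1 : ∫ x in (-w)..0, h * (1 - |x| / w) = ∫ x in (-w)..0, (h + h / w * x) := by
    refine intervalIntegral.integral_congr fun x hx => ?_
    rw [uIcc_of_le (by linarith)] at hx
    simp only [abs_of_nonpos hx.2]
    field_simp
    ring
  have h2 : ∫ x in (0)..w, h * (1 - |x| / w) = ∫ x in (0)..w, (h - h / w * x) := by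
    refine intervalIntegral.integral_congr fun x hx => ?_
    rw [uIcc_of_le hw.le] at hx
    simp only [abs_of_nonneg hx.1]
    field_simp
  rw [h1, h2, intervalIntegral.integral_add (by simp)
    (Continuous.intervalIntegrable (by fun_prop) _ _), intervalIntegral.integral_sub (by simp)
    (Continuous.intervalIntegrable (by fun_prop) _ _), intervalIntegral.integral_const,
    intervalIntegral.integral_const, intervalIntegral.integral_const_mul,
    intervalIntegral.integral_const_mul, integral_id, integral_id]
  simp only [smul_eq_mul]
  field_simp
  ring

theorem volume_tri_of_pos {w h : ℝ} (hw : 0 < w) (hh : 0 < h) :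
    volume (tri w h) = ENNReal.ofReal (w * h) := by
  have hset : tri w h = Complex.measurableEquivRealProd ⁻¹'
      regionBetween (fun _ => 0) (fun x => h * (1 - |x| / w)) (Ioo (-w) w) := by
    ext z
    simp only [tri, regionBetween, mem_ofPred_eq, mem_preimage, mem_Ioo, ← abs_lt,
      Complex.measurableEquivRealProd_apply]
    have e1 : |z.re| / w + z.im / h < 1 ↔ z.im < h * (1 - |z.re| / w) := by
      rw [← sub_pos, ← sub_pos (b := z.im),
        show h * (1 - |z.re| / w) - z.im = h * (1 - (|z.re| / w + z.im / h)) by field_simp; ring,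
        mul_pos_iff_of_pos_left hh]
    rw [e1, div_pos_iff_of_pos_right hh]
    refine ⟨fun ⟨a, b⟩ => ⟨?_, a, b⟩, fun ⟨_, a, b⟩ => ⟨a, b⟩⟩
    have : 0 < 1 - |z.re| / w := (mul_pos_iff_of_pos_left hh).mp (a.trans b)
    rwa [sub_pos, div_lt_one hw] at this
  have hint : IntegrableOn (fun x => h * (1 - |x| / w)) (Ioo (-w) w) :=
    (Continuous.integrableOn_Icc (by fun_prop)).mono_set Ioo_subset_Icc_self
  rw [hset, Complex.volume_preserving_equiv_real_prod.measure_preimage_equiv,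
    Measure.volume_eq_prod, volume_regionBetween_eq_integral (by simp) hint measurableSet_Ioo]
  · simp only [Pi.sub_apply, sub_zero]
    rw [integral_abs_symm hw]
  · intro x hx
    rw [mem_Ioo, ← abs_lt] at hx
    have : |x| / w < 1 := (div_lt_one hw).mpr hx
    have : 0 < 1 - |x| / w := by linarith
    positivity

theorem volume_tri {w h : ℝ} (hw : 0 < w) (hh : h ≠ 0) :
    volume (tri w h) = ENNReal.ofReal (w * |h|) := by
  rcases lt_or_gt_of_ne hh with hneg | hpos
  · rw [abs_of_neg hneg, ← volume_tri_of_pos hw (neg_pos.mpr hneg)]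
    have hset : tri w h = (fun z : ℂ => -z) ⁻¹' tri w (-h) := by
      ext z
      simp [tri, neg_div_neg_eq]
    rw [hset]
    exact Measure.measure_preimage_neg volume _
  · rw [abs_of_pos hpos, volume_tri_of_pos hw hpos]

theorem integrable_tri {w h : ℝ} (hw : 0 < w) (hh : h ≠ 0) :
    Integrable ((tri w h).indicator (fun _ => (1 : ℝ))) := by
  rw [integrable_indicator_iff (measurableSet_tri w h)]
  exact integrableOn_const (by rw [volume_tri hw hh]; exact ENNReal.ofReal_ne_top)

theorem integral_tri {w h : ℝ} (hw : 0 < w) (hh : h ≠ 0) :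
    ∫ z, (tri w h).indicator (fun _ => (1 : ℝ)) z = w * |h| := by
  rw [integral_indicator (measurableSet_tri w h), setIntegral_const, measureReal_def,
    volume_tri hw hh, ENNReal.toReal_ofReal (by positivity)]
  simp

/-! ### The contractions -/

/-- Twice the signed height of the triangle erected by the choice `b`. The vertical
diagonal of the rhombus joins the apex `tilt p b / 2 * I` to its negative. -/
noncomputable def tilt (p : ℝ) (b : Fin 2) : ℝ :=
  if b = 0 then Real.sqrt (4 * p - 1) else -Real.sqrt (4 * p - 1)

/-- The linear part of `φ_(a,b)`. -/
noncomputable def slope (p : ℝ) (a : Fin 4) (b : Fin 2) : ℂ :=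
  ![(p : ℂ), ((1 - 2 * p) + tilt p b * Complex.I) / 2, ((1 - 2 * p) - tilt p b * Complex.I) / 2,
    (p : ℂ)] a

/-- The value at the origin of `φ_(a,b)`. -/
noncomputable def offset (p : ℝ) (a : Fin 4) (b : Fin 2) : ℂ :=
  ![(-(1 - p) / 2 : ℂ), ((2 * p - 1) + tilt p b * Complex.I) / 4,
    ((1 - 2 * p) + tilt p b * Complex.I) / 4, ((1 - p) / 2 : ℂ)] a

/-- The inverse of `φ_(a,b)`. -/
noncomputable def ψ (p : ℝ) (a : Fin 4) (b : Fin 2) (z : ℂ) : ℂ := (z - offset p a b) / slope p a b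

theorem φ_eq (p : ℝ) (a : Fin 4) (b : Fin 2) (z : ℂ) :
    φ p a b z = slope p a b * z + offset p a b := by
  fin_cases a <;> fin_cases b <;> simp [φ, slope, offset, tilt] <;> ring

variable {p : ℝ}

theorem sqrt_pos_of_lt (hp : 1 / 4 < p) : 0 < Real.sqrt (4 * p - 1) :=
  Real.sqrt_pos.mpr (by linarith)

theorem tilt_ne_zero (hp : 1 / 4 < p) (b : Fin 2) : tilt p b ≠ 0 := by
  have := sqrt_pos_of_lt hp
  unfold tilt
  split_ifs <;> simp [this.ne']

theorem tilt_sq (hp : 1 / 4 < p) (b : Fin 2) : tilt p b * tilt p b = 4 * p - 1 := by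
  have := Real.mul_self_sqrt (show 0 ≤ 4 * p - 1 by linarith)
  unfold tilt
  split_ifs <;> linarith

theorem abs_tilt (p : ℝ) (b : Fin 2) : |tilt p b| = Real.sqrt (4 * p - 1) := by
  have := Real.sqrt_nonneg (4 * p - 1)
  unfold tilt
  split_ifs <;> simp

theorem norm_slope (hp : 1 / 4 < p) (a : Fin 4) (b : Fin 2) : ‖slope p a b‖ = p := by
  have h0 : 0 < p := by linarith
  have h1 := tilt_sq hp b
  have key : ∀ z : ℂ, z.re * z.re + z.im * z.im = p * p → ‖z‖ = p := by
    intro z hz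
    rw [Complex.norm_def, Complex.normSq_apply, hz, Real.sqrt_mul_self h0.le]
  apply key
  fin_cases a <;> simp [slope] <;> nlinarith [h1]

theorem slope_ne_zero (hp : 1 / 4 < p) (a : Fin 4) (b : Fin 2) : slope p a b ≠ 0 := by
  rw [← norm_pos_iff, norm_slope hp]
  linarith

theorem φ_ψ (hp : 1 / 4 < p) (a : Fin 4) (b : Fin 2) (z : ℂ) : φ p a b (ψ p a b z) = z := by
  rw [φ_eq, ψ, mul_div_cancel₀ _ (slope_ne_zero hp a b), sub_add_cancel]

theorem φ_sub_φ (p : ℝ) (a : Fin 4) (b : Fin 2) (z w : ℂ) :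
    φ p a b z - φ p a b w = slope p a b * (z - w) := by
  rw [φ_eq, φ_eq]
  ring

theorem φ_neg_half_zero (p : ℝ) (b : Fin 2) : φ p 0 b ((-1 / 2 : ℝ) : ℂ) = ((-1 / 2 : ℝ) : ℂ) := by
  rw [φ_eq]
  simp [slope, offset]
  ring

theorem φ_half_three (p : ℝ) (b : Fin 2) : φ p 3 b ((1 / 2 : ℝ) : ℂ) = ((1 / 2 : ℝ) : ℂ) := by
  rw [φ_eq]
  simp [slope, offset]
  ring

theorem φ_half_zero (p : ℝ) (b : Fin 2) : φ p 0 b ((1 / 2 : ℝ) : ℂ) = ((p - 1 / 2 : ℝ) : ℂ) := by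
  rw [φ_eq]
  simp [slope, offset]
  ring

theorem φ_neg_half_one (p : ℝ) (b : Fin 2) :
    φ p 1 b ((-1 / 2 : ℝ) : ℂ) = ((p - 1 / 2 : ℝ) : ℂ) := by
  rw [φ_eq]
  simp [slope, offset]
  ring

theorem φ_half_one (p : ℝ) (b : Fin 2) :
    φ p 1 b ((1 / 2 : ℝ) : ℂ) = tilt p b / 2 * Complex.I := by
  rw [φ_eq]
  simp [slope, offset]
  ring

theorem φ_neg_half_two (p : ℝ) (b : Fin 2) :
    φ p 2 b ((-1 / 2 : ℝ) : ℂ) = tilt p b / 2 * Complex.I := by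
  rw [φ_eq]
  simp [slope, offset]
  ring

theorem φ_half_two (p : ℝ) (b : Fin 2) : φ p 2 b ((1 / 2 : ℝ) : ℂ) = ((1 / 2 - p : ℝ) : ℂ) := by
  rw [φ_eq]
  simp [slope, offset]
  ring

theorem φ_neg_half_three (p : ℝ) (b : Fin 2) :
    φ p 3 b ((-1 / 2 : ℝ) : ℂ) = ((1 / 2 - p : ℝ) : ℂ) := by
  rw [φ_eq]
  simp [slope, offset]
  ring

/-- In the coordinates `(re, im / tilt)` the contractions no longer involve the square root. -/
theorem φ_re (hp : 1 / 4 < p) (a : Fin 4) (b : Fin 2) (z : ℂ) : (φ p a b z).re =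
    ![p * z.re - (1 - p) / 2,
      ((1 - 2 * p) * z.re - (4 * p - 1) * (z.im / tilt p b)) / 2 - (1 - 2 * p) / 4,
      ((1 - 2 * p) * z.re + (4 * p - 1) * (z.im / tilt p b)) / 2 + (1 - 2 * p) / 4,
      p * z.re + (1 - p) / 2] a := by
  have h := tilt_ne_zero hp b
  have h2 : (4 * p - 1) * (z.im / tilt p b) = tilt p b * z.im := by
    rw [← tilt_sq hp b]
    field_simp
  rw [φ_eq, h2]
  fin_cases a <;> simp [slope, offset] <;> ring

theorem φ_im_div (hp : 1 / 4 < p) (a : Fin 4) (b : Fin 2) (z : ℂ) :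
    (φ p a b z).im / tilt p b =
    ![p * (z.im / tilt p b),
      ((1 - 2 * p) * (z.im / tilt p b) + z.re) / 2 + 1 / 4,
      ((1 - 2 * p) * (z.im / tilt p b) - z.re) / 2 + 1 / 4,
      p * (z.im / tilt p b)] a := by
  have h := tilt_ne_zero hp b
  rw [φ_eq]
  fin_cases a <;> simp [slope, offset] <;> field_simp
  ring

theorem abs_im_div_sqrt (p : ℝ) (b : Fin 2) (z : ℂ) :
    |2 * z.im / Real.sqrt (4 * p - 1)| = 2 * |z.im / tilt p b| := by
  rw [abs_div, abs_div, abs_tilt, abs_of_nonneg (Real.sqrt_nonneg _), abs_mul, abs_two, mul_div_assoc]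

theorem mem_rhombus_iff (b : Fin 2) {z : ℂ} :
    z ∈ rhombus p ↔ 2 * |z.re| + 2 * |z.im / tilt p b| ≤ 1 := by
  rw [← abs_im_div_sqrt, ← abs_two (α := ℝ), ← abs_mul, abs_two]
  rfl

/-- The interior of the rhombus. -/
def openRhombus (p : ℝ) : Set ℂ := {z | |2 * z.re| + |2 * z.im / Real.sqrt (4 * p - 1)| < 1}

theorem mem_openRhombus_iff (b : Fin 2) {z : ℂ} :
    z ∈ openRhombus p ↔ 2 * |z.re| + 2 * |z.im / tilt p b| < 1 := by
  rw [← abs_im_div_sqrt, ← abs_two (α := ℝ), ← abs_mul, abs_two]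
  rfl

theorem two_abs_add_two_abs_le_iff {x y c : ℝ} :
    2 * |x| + 2 * |y| ≤ c ↔ 2 * x + 2 * y ≤ c ∧ 2 * x - 2 * y ≤ c ∧ -2 * x + 2 * y ≤ c ∧
      -2 * x - 2 * y ≤ c := by
  constructor
  · intro h
    have := le_abs_self x
    have := neg_abs_le x
    have := le_abs_self y
    have := neg_abs_le y
    refine ⟨?_, ?_, ?_, ?_⟩ <;> linarith
  · rintro ⟨h1, h2, h3, h4⟩
    rcases abs_cases x with h | h <;> rcases abs_cases y with h' | h' <;> linarith

theorem two_abs_add_two_abs_lt_iff {x y c : ℝ} :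
    2 * |x| + 2 * |y| < c ↔ 2 * x + 2 * y < c ∧ 2 * x - 2 * y < c ∧ -2 * x + 2 * y < c ∧
      -2 * x - 2 * y < c := by
  constructor
  · intro h
    have := le_abs_self x
    have := neg_abs_le x
    have := le_abs_self y
    have := neg_abs_le y
    refine ⟨?_, ?_, ?_, ?_⟩ <;> linarith
  · rintro ⟨h1, h2, h3, h4⟩
    rcases abs_cases x with h | h <;> rcases abs_cases y with h' | h' <;> linarith

theorem mapsTo_φ_rhombus (hp : 1 / 4 < p) (hp' : p ≤ 1 / 3) (a : Fin 4) (b : Fin 2) :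
    MapsTo (φ p a b) (rhombus p) (rhombus p) := by
  intro z hz
  rw [mem_rhombus_iff b, two_abs_add_two_abs_le_iff] at hz ⊢
  rw [φ_re hp, φ_im_div hp]
  obtain ⟨h1, h2, h3, h4⟩ := hz
  generalize z.im / tilt p b = y at *
  generalize z.re = x at *
  fin_cases a <;> simp <;> refine ⟨?_, ?_, ?_, ?_⟩ <;> nlinarith

theorem convex_rhombus (p : ℝ) : Convex ℝ (rhombus p) := by
  intro x hx y hy a b ha hb hab
  rw [mem_rhombus_iff 0, two_abs_add_two_abs_le_iff] at *
  have hre : (a • x + b • y).re = a * x.re + b * y.re := by simp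
  have him : (a • x + b • y).im / tilt p 0 = a * (x.im / tilt p 0) + b * (y.im / tilt p 0) := by
    simp
    ring
  rw [hre, him]
  obtain ⟨h1, h2, h3, h4⟩ := hx
  obtain ⟨k1, k2, k3, k4⟩ := hy
  refine ⟨?_, ?_, ?_, ?_⟩ <;> nlinarith

theorem norm_le_of_mem_rhombus (hp : 1 / 4 < p) (hp' : p ≤ 1 / 3) {z : ℂ} (hz : z ∈ rhombus p) :
    ‖z‖ ≤ 1 / 2 := by
  have hs := sqrt_pos_of_lt hp
  have hs1 : Real.sqrt (4 * p - 1) ≤ 1 := Real.sqrt_le_one.mpr (by linarith)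
  have h1 : 2 * |z.im| ≤ |2 * z.im / Real.sqrt (4 * p - 1)| := by
    rw [abs_div, abs_mul, abs_two, abs_of_pos hs, le_div_iff₀ hs]
    nlinarith [abs_nonneg z.im]
  have h2 : |2 * z.re| + |2 * z.im / Real.sqrt (4 * p - 1)| ≤ 1 := hz
  rw [abs_mul, abs_two] at h2
  linarith [Complex.norm_le_abs_re_add_abs_im z]

theorem isClosed_rhombus (p : ℝ) : IsClosed (rhombus p) :=
  isClosed_le (by fun_prop) continuous_const

theorem isCompact_rhombus (hp : 1 / 4 < p) (hp' : p ≤ 1 / 3) : IsCompact (rhombus p) :=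
  Metric.isCompact_of_isClosed_isBounded (isClosed_rhombus p)
    (Metric.isBounded_closedBall.subset fun _ hz =>
      mem_closedBall_zero_iff.mpr (norm_le_of_mem_rhombus hp hp' hz))

theorem neg_half_mem_rhombus (p : ℝ) : ((-1 / 2 : ℝ) : ℂ) ∈ rhombus p := by
  rw [mem_rhombus_iff 0]
  simp [abs_div]

theorem half_mem_rhombus (p : ℝ) : ((1 / 2 : ℝ) : ℂ) ∈ rhombus p := by
  rw [mem_rhombus_iff 0]
  simp

theorem continuous_φ (p : ℝ) (a : Fin 4) (b : Fin 2) : Continuous (φ p a b) := by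
  have : φ p a b = fun z => slope p a b * z + offset p a b := funext (φ_eq p a b)
  rw [this]
  fun_prop

/-! ### Self-similarity of the curves -/

/-- The choices that `s` makes below the segment `a` of the first generation. -/
def sub (s : Choices) (a : Fin 4) : Choices := fun k j => s (k + 1) ⟨a * 4 ^ k + j, by
  have h1 := a.isLt
  have h2 := j.isLt
  rw [pow_succ]
  nlinarith⟩

/-- The choice made by `s` for the first generation. -/
def root (s : Choices) : Fin 2 := s 0 ⟨0, by norm_num⟩

theorem address_succ_val (u : ℕ → Fin 4) (k : ℕ) : (address u (k + 1)).val =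
    u 0 * 4 ^ k + (address (fun i => u (i + 1)) k).val := by
  induction k with
  | zero => simp [address]
  | succ k ih =>
    have h1 : (address u (k + 2)).val = 4 * (address u (k + 1)).val + (u (k + 1)).val := rfl
    have h2 : (address (fun i => u (i + 1)) (k + 1)).val =
        4 * (address (fun i => u (i + 1)) k).val + (u (k + 1)).val := rfl
    rw [h1, h2, ih]
    ring

theorem sub_address (s : Choices) (u : ℕ → Fin 4) (k : ℕ) :
    sub s (u 0) k (address (fun i => u (i + 1)) k) = s (k + 1) (address u (k + 1)) := by
  unfold sub
  congr 1
  exact Fin.ext (address_succ_val u k).symm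

theorem compφ_succ' (p : ℝ) (s : Choices) (u : ℕ → Fin 4) (k : ℕ) :
    compφ p s u (k + 1) =
      φ p (u 0) (root s) ∘ compφ p (sub s (u 0)) (fun i => u (i + 1)) k := by
  induction k with
  | zero => rfl
  | succ k ih =>
    have h : compφ p s u (k + 2) =
      compφ p s u (k + 1) ∘ φ p (u (k + 1)) (s (k + 1) (address u (k + 1))) := rfl
    rw [h, ih, ← sub_address s u k]
    rfl

theorem compφ_image_anti (hp : 1 / 4 < p) (hp' : p ≤ 1 / 3) (s : Choices) (u : ℕ → Fin 4) (k : ℕ) :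
    compφ p s u (k + 1) '' rhombus p ⊆ compφ p s u k '' rhombus p := by
  rintro _ ⟨z, hz, rfl⟩
  exact ⟨_, mapsTo_φ_rhombus hp hp' _ _ hz, rfl⟩

theorem continuous_compφ (p : ℝ) (s : Choices) (u : ℕ → Fin 4) (k : ℕ) :
    Continuous (compφ p s u k) := by
  induction k with
  | zero => exact continuous_id
  | succ k ih => exact ih.comp (continuous_φ _ _ _)

theorem norm_compφ_sub (hp : 1 / 4 < p) (s : Choices) (u : ℕ → Fin 4) (k : ℕ) (z w : ℂ) :
    ‖compφ p s u k z - compφ p s u k w‖ = p ^ k * ‖z - w‖ := by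
  induction k generalizing z w with
  | zero => simp [compφ]
  | succ k ih =>
    simp only [compφ, Function.comp_apply]
    rw [ih, φ_sub_φ, norm_mul, norm_slope hp]
    ring

theorem limitSet_nonempty (hp : 1 / 4 < p) (hp' : p ≤ 1 / 3) (s : Choices) (u : ℕ → Fin 4) :
    (limitSet p s u).Nonempty := by
  have hc : ∀ k, IsCompact (compφ p s u (k + 1) '' rhombus p) := fun k =>
    (isCompact_rhombus hp hp').image (continuous_compφ p s u _)
  exact IsCompact.nonempty_iInter_of_sequence_nonempty_isCompact_isClosed _
    (fun k => compφ_image_anti hp hp' s u (k + 1))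
    (fun k => ⟨_, mem_image_of_mem _ (half_mem_rhombus p)⟩) (hc 0) fun k => (hc k).isClosed

theorem limitSet_subset_rhombus (hp : 1 / 4 < p) (hp' : p ≤ 1 / 3) (s : Choices) (u : ℕ → Fin 4) :
    limitSet p s u ⊆ rhombus p := by
  intro z hz
  obtain ⟨w, hw, rfl⟩ := mem_iInter.mp hz 0
  exact mapsTo_φ_rhombus hp hp' _ _ hw

theorem limitSet_unique (hp : 1 / 4 < p) (hp' : p ≤ 1 / 3) {s : Choices} {u : ℕ → Fin 4} {z w : ℂ}
    (hz : z ∈ limitSet p s u) (hw : w ∈ limitSet p s u) : z = w := by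
  have hb : ∀ k : ℕ, ‖z - w‖ ≤ p ^ (k + 1) := by
    intro k
    obtain ⟨z', hz', rfl⟩ := mem_iInter.mp hz k
    obtain ⟨w', hw', rfl⟩ := mem_iInter.mp hw k
    rw [norm_compφ_sub hp]
    have h1 := norm_le_of_mem_rhombus hp hp' hz'
    have h2 := norm_le_of_mem_rhombus hp hp' hw'
    have h3 : 0 ≤ p ^ (k + 1) := pow_nonneg (by linarith) _
    nlinarith [norm_sub_le z' w']
  have ht : Tendsto (fun k : ℕ => p ^ (k + 1)) atTop (𝓝 0) :=
    (tendsto_pow_atTop_nhds_zero_of_lt_one (by linarith) (by linarith)).comp (tendsto_add_atTop_nat 1)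
  have := ge_of_tendsto' ht hb
  exact sub_eq_zero.mp (norm_le_zero_iff.mp this)

theorem φ_mem_limitSet (hp : 1 / 4 < p) (hp' : p ≤ 1 / 3) {s : Choices} {u : ℕ → Fin 4} {z : ℂ}
    (hz : z ∈ limitSet p (sub s (u 0)) fun i => u (i + 1)) :
    φ p (u 0) (root s) z ∈ limitSet p s u := by
  refine mem_iInter.mpr fun k => ?_
  rw [compφ_succ', image_comp]
  refine mem_image_of_mem _ ?_
  cases k with
  | zero => exact ⟨z, limitSet_subset_rhombus hp hp' _ _ hz, rfl⟩
  | succ k => exact mem_iInter.mp hz k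

theorem exists_of_mem_limitSet (hp : 1 / 4 < p) (hp' : p ≤ 1 / 3) {s : Choices} {u : ℕ → Fin 4}
    {z : ℂ} (hz : z ∈ limitSet p s u) :
    ∃ w ∈ limitSet p (sub s (u 0)) (fun i => u (i + 1)), φ p (u 0) (root s) w = z := by
  obtain ⟨w, hw⟩ := limitSet_nonempty hp hp' (sub s (u 0)) fun i => u (i + 1)
  exact ⟨w, hw, limitSet_unique hp hp' (φ_mem_limitSet hp hp' hw) hz⟩

theorem curveParam_mem (hp : 1 / 4 < p) (hp' : p ≤ 1 / 3) (s : Choices) (t : ℝ) :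
    curveParam p s t ∈ limitSet p s (baseFour t) :=
  Classical.epsilon_spec (limitSet_nonempty hp hp' s (baseFour t))

theorem curveParam_eq (hp : 1 / 4 < p) (hp' : p ≤ 1 / 3) {s : Choices} {t : ℝ} {z : ℂ}
    (hz : z ∈ limitSet p s (baseFour t)) : curveParam p s t = z :=
  limitSet_unique hp hp' (curveParam_mem hp hp' s t) hz

theorem curveParam_mem_rhombus (hp : 1 / 4 < p) (hp' : p ≤ 1 / 3) (s : Choices) (t : ℝ) :
    curveParam p s t ∈ rhombus p :=
  limitSet_subset_rhombus hp hp' _ _ (curveParam_mem hp hp' s t)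

theorem mem_limitSet_of_fixed (s : Choices) {a : Fin 4} {z : ℂ} (hz : z ∈ rhombus p)
    (hfix : ∀ b, φ p a b z = z) : z ∈ limitSet p s fun _ => a := by
  have h : ∀ k, compφ p s (fun _ => a) k z = z := by
    intro k
    induction k with
    | zero => rfl
    | succ k ih =>
      simp only [compφ, Function.comp_apply]
      rw [hfix, ih]
  exact mem_iInter.mpr fun k => ⟨z, hz, h _⟩

theorem baseFour_zero : baseFour 0 = fun _ => 0 := by
  funext i
  simp [baseFour, Real.digits]

theorem baseFour_one : baseFour 1 = fun _ => 3 := by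
  simp [baseFour]

theorem curveParam_zero (hp : 1 / 4 < p) (hp' : p ≤ 1 / 3) (s : Choices) :
    curveParam p s 0 = ((-1 / 2 : ℝ) : ℂ) := by
  apply curveParam_eq hp hp'
  rw [baseFour_zero]
  exact mem_limitSet_of_fixed s (neg_half_mem_rhombus p) (φ_neg_half_zero p)

theorem curveParam_one (hp : 1 / 4 < p) (hp' : p ≤ 1 / 3) (s : Choices) :
    curveParam p s 1 = ((1 / 2 : ℝ) : ℂ) := by
  apply curveParam_eq hp hp'
  rw [baseFour_one]
  exact mem_limitSet_of_fixed s (half_mem_rhombus p) (φ_half_three p)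

theorem baseFour_add_div_four {t : ℝ} (h0 : 0 ≤ t) (h1 : t < 1) (a : Fin 4) :
    baseFour ((a + t) / 4) 0 = a ∧ (fun i => baseFour ((a + t) / 4) (i + 1)) = baseFour t := by
  have ha : ((a : ℕ) : ℝ) ≤ 3 := by exact_mod_cast Nat.lt_succ_iff.mp a.isLt
  have h2 : ((a : ℕ) + t) / 4 < 1 := by linarith
  rw [baseFour, if_pos h2, baseFour, if_pos h1]
  constructor
  · have : ⌊((a : ℕ) + t) / 4 * ((4 : ℕ) : ℝ) ^ (0 + 1)⌋₊ = (a : ℕ) := by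
      rw [show ((a : ℕ) + t) / 4 * ((4 : ℕ) : ℝ) ^ (0 + 1) = t + (a : ℕ) by push_cast; ring,
        Nat.floor_add_natCast h0, Nat.floor_eq_zero.mpr h1, zero_add]
    rw [Real.digits, this]
    simp
  · funext i
    have : ⌊((a : ℕ) + t) / 4 * ((4 : ℕ) : ℝ) ^ (i + 1 + 1)⌋₊ =
        ⌊t * ((4 : ℕ) : ℝ) ^ (i + 1)⌋₊ + a * 4 ^ (i + 1) := by
      rw [← Nat.floor_add_natCast (by positivity)]
      congr 1
      push_cast
      ring
    rw [Real.digits, Real.digits, this]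
    apply Fin.ext
    simp [Fin.ofNat, pow_succ, ← mul_assoc]

theorem baseFour_three_add_one_div_four :
    baseFour (((3 : Fin 4) + (1 : ℝ)) / 4) 0 = 3 ∧
      (fun i => baseFour (((3 : Fin 4) + (1 : ℝ)) / 4) (i + 1)) = baseFour 1 := by
  have : ((3 : Fin 4) + (1 : ℝ)) / 4 = 1 := by
    norm_num [show ((3 : Fin 4) : ℕ) = 3 from rfl]
  rw [this, baseFour_one]
  simp

/-- The parameterised curve consists of four scaled copies of parameterised curves. At the common
end of two of them both descriptions agree, although only one belongs to the digits in use. -/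
theorem curveParam_add_div_four (hp : 1 / 4 < p) (hp' : p ≤ 1 / 3) (s : Choices) (a : Fin 4)
    {t : ℝ} (ht : t ∈ Icc (0 : ℝ) 1) :
    curveParam p s ((a + t) / 4) = φ p a (root s) (curveParam p (sub s a) t) := by
  have key : ∀ (c : Fin 4) (x : ℝ), baseFour ((c + x) / 4) 0 = c →
      (fun i => baseFour ((c + x) / 4) (i + 1)) = baseFour x →
      curveParam p s ((c + x) / 4) = φ p c (root s) (curveParam p (sub s c) x) := by
    intro c x h1 h2
    apply curveParam_eq hp hp'
    have := φ_mem_limitSet hp hp' (s := s) (u := baseFour ((c + x) / 4))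
      (z := curveParam p (sub s c) x)
    rw [h2, h1] at this
    exact this (curveParam_mem hp hp' _ _)
  rcases ht.2.lt_or_eq with hlt | rfl
  · exact key a t (baseFour_add_div_four ht.1 hlt a).1 (baseFour_add_div_four ht.1 hlt a).2
  · have next : ∀ c : Fin 4, (a : ℕ) + 1 = c →
        φ p c (root s) ((-1 / 2 : ℝ) : ℂ) = φ p a (root s) ((1 / 2 : ℝ) : ℂ) →
        curveParam p s ((a + 1) / 4) = φ p a (root s) (curveParam p (sub s a) 1) := by
      intro c hc h
      have hc' : (((a : ℕ) : ℝ) + 1) / 4 = ((c : ℕ) + (0 : ℝ)) / 4 := by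
        rw [← hc]
        push_cast
        ring
      have hb := baseFour_add_div_four (t := 0) le_rfl one_pos c
      rw [hc', key c 0 hb.1 hb.2, curveParam_zero hp hp', curveParam_one hp hp', h]
    fin_cases a
    · exact next 1 rfl ((φ_neg_half_one p _).trans (φ_half_zero p _).symm)
    · exact next 2 rfl ((φ_neg_half_two p _).trans (φ_half_one p _).symm)
    · exact next 3 rfl ((φ_neg_half_three p _).trans (φ_half_two p _).symm)
    · exact key 3 1 baseFour_three_add_one_div_four.1 baseFour_three_add_one_div_four.2

theorem Icc_eq_iUnion_quarters :
    Icc (0 : ℝ) 1 = ⋃ a : Fin 4, Icc ((a : ℕ) / 4 : ℝ) (((a : ℕ) + 1) / 4) := by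
  ext t
  simp only [mem_iUnion, mem_Icc]
  constructor
  · rintro ⟨h0, h1⟩
    by_cases c1 : t ≤ 1 / 4
    · exact ⟨0, by norm_num; constructor <;> linarith⟩
    by_cases c2 : t ≤ 2 / 4
    · exact ⟨1, by norm_num; constructor <;> linarith⟩
    by_cases c3 : t ≤ 3 / 4
    · exact ⟨2, by norm_num; constructor <;> linarith⟩
    · refine ⟨3, ?_⟩
      rw [show (((3 : Fin 4) : ℕ) : ℝ) = 3 by norm_num [show ((3 : Fin 4) : ℕ) = 3 from rfl]]
      constructor <;> linarith
  · rintro ⟨a, h0, h1⟩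
    have ha : ((a : ℕ) : ℝ) ≤ 3 := by exact_mod_cast Nat.lt_succ_iff.mp a.isLt
    have ha0 : (0 : ℝ) ≤ (a : ℕ) := Nat.cast_nonneg _
    constructor <;> linarith

/-- Near each parameter the oscillation of the curve is at most `p ^ n`, for every `n`: within each
quarter of `[0, 1]` the curve is a copy contracted by `p`. -/
theorem eventually_norm_curveParam_sub_le (hp : 1 / 4 < p) (hp' : p ≤ 1 / 3) (n : ℕ) (s : Choices)
    {t : ℝ} (ht : t ∈ Icc (0 : ℝ) 1) :
    ∀ᶠ x in 𝓝[Icc 0 1] t, ‖curveParam p s x - curveParam p s t‖ ≤ p ^ n := by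
  induction n generalizing s t with
  | zero =>
    refine Eventually.of_forall fun x => ?_
    have h1 := norm_le_of_mem_rhombus hp hp' (curveParam_mem_rhombus hp hp' s x)
    have h2 := norm_le_of_mem_rhombus hp hp' (curveParam_mem_rhombus hp hp' s t)
    rw [pow_zero]
    linarith [norm_sub_le (curveParam p s x) (curveParam p s t)]
  | succ n ih =>
    rw [Icc_eq_iUnion_quarters, nhdsWithin_iUnion, eventually_iSup]
    intro a
    by_cases hta : t ∈ Icc ((a : ℕ) / 4 : ℝ) (((a : ℕ) + 1) / 4)
    · have hmaps : ∀ x ∈ Icc ((a : ℕ) / 4 : ℝ) (((a : ℕ) + 1) / 4),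
          4 * x - (a : ℕ) ∈ Icc (0 : ℝ) 1 := fun x hx => ⟨by linarith [hx.1], by linarith [hx.2]⟩
      have hφ : ∀ x ∈ Icc ((a : ℕ) / 4 : ℝ) (((a : ℕ) + 1) / 4), curveParam p s x =
          φ p a (root s) (curveParam p (sub s a) (4 * x - (a : ℕ))) := by
        intro x hx
        rw [← curveParam_add_div_four hp hp' s a (hmaps x hx)]
        congr 1
        ring
      have htend : Tendsto (fun x : ℝ => 4 * x - (a : ℕ))
          (𝓝[Icc ((a : ℕ) / 4 : ℝ) (((a : ℕ) + 1) / 4)] t) (𝓝[Icc 0 1] (4 * t - (a : ℕ))) :=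
        ContinuousWithinAt.tendsto_nhdsWithin (by fun_prop) hmaps
      filter_upwards [htend.eventually (ih (sub s a) (hmaps t hta)), self_mem_nhdsWithin]
        with x hx hxa
      rw [hφ x hxa, hφ t hta, φ_sub_φ, norm_mul, norm_slope hp, pow_succ']
      exact mul_le_mul_of_nonneg_left hx (by linarith)
    · have : 𝓝[Icc ((a : ℕ) / 4 : ℝ) (((a : ℕ) + 1) / 4)] t = ⊥ := by
        rwa [← notMem_closure_iff_nhdsWithin_eq_bot, isClosed_Icc.closure_eq]
      rw [this]
      exact eventually_bot

theorem continuousOn_curveParam (hp : 1 / 4 < p) (hp' : p ≤ 1 / 3) (s : Choices) :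
    ContinuousOn (curveParam p s) (Icc 0 1) := by
  intro t ht
  rw [ContinuousWithinAt, Metric.tendsto_nhds]
  intro ε hε
  obtain ⟨n, hn⟩ := exists_pow_lt_of_lt_one hε (show p < 1 by linarith)
  filter_upwards [eventually_norm_curveParam_sub_le hp hp' n s ht] with x hx
  rw [dist_eq_norm]
  exact hx.trans_lt hn

/-! ### The index of a curve -/

/-- The open triangle that the choice `b` erects on the middle part of the segment `[-1/2, 1/2]`. -/
noncomputable def bump (p : ℝ) (b : Fin 2) : Set ℂ := tri (1 / 2 - p) (tilt p b / 2)

/-- The sign `1` of upward and `-1` of downward triangles. -/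
def orient (b : Fin 2) : ℤ := if b = 0 then 1 else -1

open Classical in
/-- The total number of triangles, among those erected in the first `n` steps, that contain `z`,
counted with sign. For points away from the `n`-th approximation this is the number of turns that the
curve, closed up by the segment from `1/2` to `-1/2`, makes clockwise around `z`. -/
noncomputable def index (p : ℝ) : ℕ → Choices → ℂ → ℤ
  | 0, _, _ => 0
  | n + 1, s, z => (if z ∈ bump p (root s) then orient (root s) else 0) +
      ∑ a, index p n (sub s a) (ψ p a (root s) z)

/-- The union of the `4 ^ n` rhombi of generation `n`, which contain the curve. -/
def cover (p : ℝ) : ℕ → Choices → Set ℂ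
  | 0, _ => rhombus p
  | n + 1, s => ⋃ a, φ p a (root s) '' cover p n (sub s a)

theorem mem_bump_iff (hp : 1 / 4 < p) (hp' : p ≤ 1 / 3) (b : Fin 2) (z : ℂ) : z ∈ bump p b ↔
    0 < z.im / tilt p b ∧ |z.re| + (1 - 2 * p) * (z.im / tilt p b) < (1 - 2 * p) / 2 := by
  have h : z.im / (tilt p b / 2) = 2 * (z.im / tilt p b) := by
    rw [div_div_eq_mul_div]
    ring
  have hq : 0 < 1 / 2 - p := by linarith
  simp only [bump, tri, mem_ofPred_eq, h]
  generalize z.im / tilt p b = y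
  refine and_congr (by simp) ?_
  rw [div_add' _ _ _ hq.ne', div_lt_one hq]
  constructor <;> intro h <;> linarith

theorem bump_subset (hp : 1 / 4 < p) (hp' : p ≤ 1 / 3) (b : Fin 2) :
    bump p b ⊆ openRhombus p := by
  intro z hz
  rw [mem_bump_iff hp hp'] at hz
  rw [mem_openRhombus_iff b, abs_of_pos hz.1]
  have := abs_nonneg z.re
  have h1 := hz.1
  have h2 := hz.2
  generalize z.im / tilt p b = y at *
  nlinarith

/-- The heights over the second and third segment of the next generation, as functions of the point. -/
theorem ψ_inner_relations (hp : 1 / 4 < p) (b : Fin 2) (z : ℂ) :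
    -z.re + (1 - 2 * p) * (z.im / tilt p b) =
      (1 - 2 * p) / 2 + 2 * p ^ 2 * ((ψ p 1 b z).im / tilt p b) ∧
    z.re + (1 - 2 * p) * (z.im / tilt p b) =
      (1 - 2 * p) / 2 + 2 * p ^ 2 * ((ψ p 2 b z).im / tilt p b) := by
  have r1 := φ_re hp 1 b (ψ p 1 b z)
  have i1 := φ_im_div hp 1 b (ψ p 1 b z)
  have r2 := φ_re hp 2 b (ψ p 2 b z)
  have i2 := φ_im_div hp 2 b (ψ p 2 b z)
  rw [φ_ψ hp] at r1 i1 r2 i2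
  simp only [Matrix.cons_val] at r1 i1 r2 i2
  constructor
  · rw [r1, i1]
    ring
  · rw [r2, i2]
    ring

/-- A point lies in the triangle if and only if it lies on the inner side of all three edges; two of
them are the second and third segment of the next generation. -/
theorem mem_bump_iff_ψ (hp : 1 / 4 < p) (hp' : p ≤ 1 / 3) (b : Fin 2) (z : ℂ) : z ∈ bump p b ↔
    0 < z.im / tilt p b ∧ (ψ p 1 b z).im / tilt p b < 0 ∧ (ψ p 2 b z).im / tilt p b < 0 := by
  obtain ⟨e1, e2⟩ := ψ_inner_relations hp b z
  rw [mem_bump_iff hp hp']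
  generalize z.im / tilt p b = y at *
  generalize (ψ p 1 b z).im / tilt p b = y1 at *
  generalize (ψ p 2 b z).im / tilt p b = y2 at *
  have hpp : 0 < 2 * p ^ 2 := by positivity
  refine and_congr Iff.rfl ?_
  rw [← lt_sub_iff_add_lt, abs_lt]
  constructor
  · rintro ⟨h1, h2⟩
    constructor
    · by_contra! h
      nlinarith [mul_nonneg hpp.le h]
    · by_contra! h
      nlinarith [mul_nonneg hpp.le h]
  · rintro ⟨h1, h2⟩
    constructor <;> nlinarith [mul_pos hpp (neg_pos.mpr h1), mul_pos hpp (neg_pos.mpr h2)]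

/-- No point lies on the outer side of all three edges of the triangle. -/
theorem not_outer_side (hp : 1 / 4 < p) (hp' : p ≤ 1 / 3) (b : Fin 2) (z : ℂ) :
    ¬(z.im / tilt p b < 0 ∧ 0 < (ψ p 1 b z).im / tilt p b ∧ 0 < (ψ p 2 b z).im / tilt p b) := by
  obtain ⟨e1, e2⟩ := ψ_inner_relations hp b z
  rintro ⟨h, h1, h2⟩
  have hpp : 0 < 2 * p ^ 2 := by positivity
  nlinarith [mul_pos hpp h1, mul_pos hpp h2]

theorem mapsTo_φ_openRhombus (hp : 1 / 4 < p) (hp' : p ≤ 1 / 3) (a : Fin 4) (b : Fin 2) :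
    MapsTo (φ p a b) (openRhombus p) (openRhombus p) := by
  intro z hz
  rw [mem_openRhombus_iff b, two_abs_add_two_abs_lt_iff] at hz ⊢
  rw [φ_re hp, φ_im_div hp]
  obtain ⟨h1, h2, h3, h4⟩ := hz
  generalize z.im / tilt p b = y at *
  generalize z.re = x at *
  fin_cases a <;> simp <;> refine ⟨?_, ?_, ?_, ?_⟩ <;> nlinarith

/-- The four open rhombi of the first generation lie over disjoint intervals of the real axis; for the
middle two this uses `p ≤ 1/3`. -/
theorem φ_re_mem (hp : 1 / 4 < p) (hp' : p ≤ 1 / 3) (a : Fin 4) (b : Fin 2) {z : ℂ}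
    (hz : z ∈ openRhombus p) : (φ p a b z).re ∈
      Ioo (![-1 / 2, p - 1 / 2, 0, 1 / 2 - p] a) (![p - 1 / 2, 0, 1 / 2 - p, 1 / 2] a) := by
  rw [mem_openRhombus_iff b, two_abs_add_two_abs_lt_iff] at hz
  rw [φ_re hp]
  obtain ⟨h1, h2, h3, h4⟩ := hz
  generalize z.im / tilt p b = y at *
  generalize z.re = x at *
  fin_cases a <;> simp <;> constructor <;> nlinarith

theorem eq_of_φ_eq (hp : 1 / 4 < p) (hp' : p ≤ 1 / 3) {a c : Fin 4} {b : Fin 2} {z w : ℂ}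
    (hz : z ∈ openRhombus p) (hw : w ∈ openRhombus p) (h : φ p a b z = φ p c b w) : a = c := by
  have h1 := φ_re_mem hp hp' a b hz
  have h2 := φ_re_mem hp hp' c b hw
  rw [← h] at h2
  generalize (φ p a b z).re = x at *
  obtain ⟨h1, h1'⟩ := h1
  obtain ⟨h2, h2'⟩ := h2
  fin_cases a <;> fin_cases c <;> simp at h1 h1' h2 h2' ⊢ <;> linarith

theorem φ_outer_notMem_bump (hp : 1 / 4 < p) (hp' : p ≤ 1 / 3) {a : Fin 4} (ha : a = 0 ∨ a = 3)
    (b : Fin 2) {z : ℂ} (hz : z ∈ openRhombus p) : φ p a b z ∉ bump p b := by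
  rw [mem_bump_iff hp hp']
  rintro ⟨h1, h2⟩
  have h3 : 0 < (1 - 2 * p) * ((φ p a b z).im / tilt p b) := mul_pos (by linarith) h1
  have h4 := φ_re_mem hp hp' a b hz
  have h5 := abs_lt.mp (show |(φ p a b z).re| < (1 - 2 * p) / 2 by linarith)
  rcases ha with rfl | rfl
  · have : (φ p 0 b z).re < p - 1 / 2 := h4.2
    linarith [h5.1]
  · have : 1 / 2 - p < (φ p 3 b z).re := h4.1
    linarith [h5.2]

theorem φ_inner_mem_bump_iff (hp : 1 / 4 < p) (hp' : p ≤ 1 / 3) {a : Fin 4} (ha : a = 1 ∨ a = 2)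
    (b : Fin 2) {z : ℂ} (hz : z ∈ openRhombus p) :
    0 < (φ p a b z).im / tilt p b ∧ (φ p a b z ∈ bump p b ↔ z.im / tilt p b < 0) := by
  have h4 := φ_re_mem hp hp' a b hz
  rw [mem_openRhombus_iff b, two_abs_add_two_abs_lt_iff] at hz
  obtain ⟨h1, h2, h3, h5⟩ := hz
  have hr := φ_re hp a b z
  have hi := φ_im_div hp a b z
  have hpos : 0 < (φ p a b z).im / tilt p b := by
    rcases ha with rfl | rfl <;> simp only [Matrix.cons_val] at hi <;> rw [hi] <;> nlinarith
  refine ⟨hpos, ?_⟩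
  rw [mem_bump_iff hp hp', and_iff_right hpos]
  have hpp : 0 < 2 * p ^ 2 := by positivity
  have e1 : |(φ p a b z).re| + (1 - 2 * p) * ((φ p a b z).im / tilt p b) =
      (1 - 2 * p) / 2 + 2 * p ^ 2 * (z.im / tilt p b) := by
    rcases ha with rfl | rfl
    · have hneg : (φ p 1 b z).re < 0 := h4.2
      simp only [Matrix.cons_val] at hr hi
      rw [abs_of_neg hneg, hr, hi]
      ring
    · have hneg : 0 < (φ p 2 b z).re := h4.1
      simp only [Matrix.cons_val] at hr hi
      rw [abs_of_pos hneg, hr, hi]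
      ring
  rw [e1, add_lt_iff_neg_left, ← neg_pos, ← mul_neg, mul_pos_iff_of_pos_left hpp, neg_pos]

theorem tilt_zero_pos (hp : 1 / 4 < p) : 0 < tilt p 0 := by
  simpa [tilt] using sqrt_pos_of_lt hp

theorem tilt_one_neg (hp : 1 / 4 < p) : tilt p 1 < 0 := by
  simpa [tilt] using sqrt_pos_of_lt hp

theorem φ_outer_im (a : Fin 4) (ha : a = 0 ∨ a = 3) (b : Fin 2) (z : ℂ) :
    (φ p a b z).im = p * z.im := by
  rw [φ_eq]
  rcases ha with rfl | rfl <;> simp [slope, offset]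

theorem orient_zero : orient 0 = 1 := rfl

theorem orient_one : orient 1 = -1 := rfl

/-- Where the index can be nonzero: only in the open rhombus, being `0` or `1` in its upper half and
`0` or `-1` in its lower half. The reason is that the triangle `bump p b` contains exactly the inner
halves of the two rhombi over its sides, where it cancels a possible index of opposite sign. -/
theorem index_range (hp : 1 / 4 < p) (hp' : p ≤ 1 / 3) (n : ℕ) (s : Choices) (z : ℂ) :
    (z ∉ openRhombus p → index p n s z = 0) ∧
    (0 ≤ z.im → index p n s z = 0 ∨ index p n s z = 1) ∧
    (z.im ≤ 0 → index p n s z = 0 ∨ index p n s z = -1) := by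
  induction n generalizing s z with
  | zero => simp [index]
  | succ n ih =>
    rw [index]
    generalize root s = b
    by_cases h : ∃ a, ψ p a b z ∈ openRhombus p
    · obtain ⟨a, ha⟩ := h
      obtain ⟨w, hw⟩ : ∃ w, w = ψ p a b z := ⟨_, rfl⟩
      rw [← hw] at ha
      have hz : z = φ p a b w := by rw [hw, φ_ψ hp]
      have hsum : ∑ c, index p n (sub s c) (ψ p c b z) = index p n (sub s a) w := by
        rw [Finset.sum_eq_single a, hw]
        · intro c _ hca
          refine (ih _ _).1 fun hc => hca ?_
          exact (eq_of_φ_eq hp hp' (b := b) ha hc (by rw [φ_ψ hp, hz])).symm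
        · simp
      rw [hsum]
      obtain ⟨-, ih1, ih2⟩ := ih (sub s a) w
      refine ⟨fun h => absurd ?_ h, ?_⟩
      · rw [hz]
        exact mapsTo_φ_openRhombus hp hp' a b ha
      have ha4 : (a = 0 ∨ a = 3) ∨ (a = 1 ∨ a = 2) := by
        fin_cases a <;> simp
      rcases ha4 with ha4 | ha4
      · have him := φ_outer_im (p := p) a ha4 b w
        have hnot := φ_outer_notMem_bump hp hp' ha4 b ha
        rw [hz, if_neg hnot, him, zero_add]
        exact ⟨fun h => ih1 (nonneg_of_mul_nonneg_right h (by linarith)), fun h => ih2 (by nlinarith)⟩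
      · obtain ⟨hpos, hiff⟩ := φ_inner_mem_bump_iff hp hp' ha4 b ha
        rw [← hz] at hpos hiff
        have hb : b = 0 ∨ b = 1 := by fin_cases b <;> simp
        rcases hb with rfl | rfl
        · have ht := tilt_zero_pos hp
          rw [div_pos_iff_of_pos_right ht] at hpos
          rw [div_lt_iff₀ ht, zero_mul] at hiff
          simp only [hiff, orient_zero]
          refine ⟨fun _ => ?_, fun h => absurd hpos (not_lt.mpr h)⟩
          split_ifs with hc
          · rcases ih2 hc.le with h | h <;> simp [h]
          · rcases ih1 (not_lt.mp hc) with h | h <;> simp [h]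
        · have ht := tilt_one_neg hp
          rw [← neg_div_neg_eq, div_pos_iff_of_pos_right (neg_pos.mpr ht), neg_pos] at hpos
          rw [div_lt_iff_of_neg ht, zero_mul] at hiff
          simp only [hiff, orient_one]
          refine ⟨fun h => absurd hpos (not_lt.mpr h), fun _ => ?_⟩
          split_ifs with hc
          · rcases ih1 hc.le with h | h <;> simp [h]
          · rcases ih2 (not_lt.mp hc) with h | h <;> simp [h]
    · push Not at h
      rw [Finset.sum_eq_zero fun a _ => (ih _ _).1 (h a), add_zero]
      split_ifs with hz
      · refine ⟨fun hn => absurd (bump_subset hp hp' b hz) hn, ?_⟩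
        have hpos := ((mem_bump_iff hp hp' b z).mp hz).1
        have hb : b = 0 ∨ b = 1 := by fin_cases b <;> simp
        rcases hb with rfl | rfl
        · have ht := tilt_zero_pos hp
          rw [div_pos_iff_of_pos_right ht] at hpos
          exact ⟨fun _ => Or.inr rfl, fun h => absurd hpos (not_lt.mpr h)⟩
        · have ht := tilt_one_neg hp
          rw [← neg_div_neg_eq, div_pos_iff_of_pos_right (neg_pos.mpr ht), neg_pos] at hpos
          exact ⟨fun h => absurd hpos (not_lt.mpr h), fun _ => Or.inr rfl⟩
      · simp

/-! ### The increment of the logarithm along a curve -/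

theorem HasLogIncrement.quarters {γ : ℝ → ℂ} {z : ℂ} {w : Fin 4 → ℂ}
    (h : ∀ a : Fin 4, HasLogIncrement γ z ((a : ℕ) / 4) (((a : ℕ) + 1) / 4) (w a)) :
    HasLogIncrement γ z 0 1 (∑ a, w a) := by
  have h0 := h 0
  have h1 := h 1
  have h2 := h 2
  have h3 := h 3
  rw [show (((0 : Fin 4) : ℕ) : ℝ) / 4 = 0 by simp,
    show ((((0 : Fin 4) : ℕ) : ℝ) + 1) / 4 = 1 / 4 by simp] at h0
  rw [show (((1 : Fin 4) : ℕ) : ℝ) / 4 = 1 / 4 by simp,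
    show ((((1 : Fin 4) : ℕ) : ℝ) + 1) / 4 = 2 / 4 by norm_num] at h1
  rw [show (((2 : Fin 4) : ℕ) : ℝ) / 4 = 2 / 4 by norm_num,
    show ((((2 : Fin 4) : ℕ) : ℝ) + 1) / 4 = 3 / 4 by norm_num] at h2
  rw [show (((3 : Fin 4) : ℕ) : ℝ) / 4 = 3 / 4 by norm_num [show ((3 : Fin 4) : ℕ) = 3 from rfl],
    show ((((3 : Fin 4) : ℕ) : ℝ) + 1) / 4 = 1 by
      norm_num [show ((3 : Fin 4) : ℕ) = 3 from rfl]] at h3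
  rw [Fin.sum_univ_four]
  exact ((h0.trans (by norm_num) (by norm_num) h1).trans (by norm_num) (by norm_num) h2).trans
    (by norm_num) (by norm_num) h3

theorem φ_sub (hp : 1 / 4 < p) (a : Fin 4) (b : Fin 2) (w z : ℂ) :
    φ p a b w - z = slope p a b * (w - ψ p a b z) := by
  rw [← φ_sub_φ, φ_ψ hp]

theorem φ_ratio (hp : 1 / 4 < p) (a : Fin 4) (b : Fin 2) (z w w' : ℂ) :
    (w - ψ p a b z) / (w' - ψ p a b z) = (φ p a b w - z) / (φ p a b w' - z) := by
  rw [φ_sub hp, φ_sub hp, mul_div_mul_left _ _ (slope_ne_zero hp a b)]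

open Classical in
/-- Replacing the segment `[-1/2, 1/2]` by its four images changes the increment of the logarithm about
a point by a full turn exactly when the point lies in the triangle between them. -/
theorem sum_segLog_ψ (hp : 1 / 4 < p) (hp' : p ≤ 1 / 3) (b : Fin 2) {z : ℂ} (hz : z.im ≠ 0)
    (h1 : (ψ p 1 b z).im ≠ 0) (h2 : (ψ p 2 b z).im ≠ 0) :
    ∑ a, segLog (ψ p a b z) = segLog z -
      2 * Real.pi * Complex.I * ((if z ∈ bump p b then orient b else 0 : ℤ) : ℂ) := by
  have hq : p - 1 / 2 < 1 / 2 - p := by linarith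
  have e0 := log_div_add_log_div (show (-1 / 2 : ℝ) < p - 1 / 2 by linarith) hq hz
  have e1 := log_div_add_log_div (show (-1 / 2 : ℝ) < 1 / 2 - p by linarith)
    (show 1 / 2 - p < 1 / 2 by linarith) hz
  have hc := im_div_real_ne hq hz
  have hlt : (-1 / 2 : ℝ) < 1 / 2 := by norm_num
  have e2 := log_add_log_add_log (im_div_real_ne hlt h1) (im_div_real_ne hlt h2) (inv_im_ne hc) (by
    have hP := real_sub_ne (p - 1 / 2) hz
    have hQ := real_sub_ne (1 / 2 - p) hz
    have hA : (tilt p b / 2 * Complex.I - z : ℂ) ≠ 0 := by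
      rw [← φ_half_one, φ_sub hp]
      exact mul_ne_zero (slope_ne_zero hp 1 b) (real_sub_ne (1 / 2) h1)
    rw [φ_ratio hp, φ_ratio hp, φ_half_one, φ_neg_half_one, φ_half_two, φ_neg_half_two]
    generalize (tilt p b / 2 * Complex.I - z : ℂ) = A at hA ⊢
    generalize (((p - 1 / 2 : ℝ) : ℂ) - z) = P at hP ⊢
    generalize (((1 / 2 - p : ℝ) : ℂ) - z) = Q at hQ ⊢
    field_simp)
  rw [log_inv_of_im_ne hc] at e2
  simp only [im_div_real_pos hlt h1, im_div_real_pos hlt h2, im_div_real_neg hlt h1,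
    im_div_real_neg hlt h2, inv_im_pos hc, inv_im_neg hc, im_div_real_pos hq hz,
    im_div_real_neg hq hz] at e2
  have hsign : ((if 0 < (ψ p 1 b z).im ∧ 0 < (ψ p 2 b z).im ∧ z.im < 0 then 1 else 0 : ℤ) -
      (if (ψ p 1 b z).im < 0 ∧ (ψ p 2 b z).im < 0 ∧ 0 < z.im then 1 else 0 : ℤ)) =
      -(if z ∈ bump p b then orient b else 0 : ℤ) := by
    have hbump := mem_bump_iff_ψ hp hp' b z
    have hnot := not_outer_side hp hp' b z
    have hb : b = 0 ∨ b = 1 := by fin_cases b <;> simp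
    rcases hb with rfl | rfl
    · have ht := tilt_zero_pos hp
      simp only [div_pos_iff_of_pos_right ht, div_lt_iff₀ ht, zero_mul] at hbump hnot
      simp only [hbump, orient_zero]
      split_ifs <;> first | rfl | (exfalso; tauto)
    · have ht := tilt_one_neg hp
      simp only [lt_div_iff_of_neg ht, div_lt_iff_of_neg ht, zero_mul] at hbump hnot
      simp only [hbump, orient_one]
      split_ifs <;> first | rfl | (exfalso; tauto)
  rw [hsign] at e2
  rw [Fin.sum_univ_four]
  simp only [segLog, φ_ratio hp, φ_half_zero, φ_neg_half_zero, φ_half_three, φ_neg_half_three]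
    at e2 ⊢
  push_cast at e0 e1 e2 ⊢
  linear_combination e0 + e1 + e2

/-- Off the approximation by rhombi of generation `n`, the increment of the logarithm along a curve
differs from the increment along the segment joining its ends by `index` full turns. Points on the
line of some segment of generation at most `n`, a null set, are left aside. -/
theorem ae_hasLogIncrement (hp : 1 / 4 < p) (hp' : p ≤ 1 / 3) (n : ℕ) (s : Choices) :
    ∀ᵐ z : ℂ, z ∉ cover p n s → HasLogIncrement (curveParam p s) z 0 1
      (segLog z - 2 * Real.pi * Complex.I * (index p n s z : ℂ)) := by
  induction n generalizing s with
  | zero =>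
    refine Eventually.of_forall fun z hz => ?_
    have h := HasLogIncrement.of_convex zero_le_one (convex_rhombus p) hz
      (continuousOn_curveParam hp hp' s) fun t _ => curveParam_mem_rhombus hp hp' s t
    rw [curveParam_zero hp hp', curveParam_one hp hp'] at h
    simpa [index, segLog] using h
  | succ n ih =>
    have hψ : ∀ (a : Fin 4) {P : ℂ → Prop}, (∀ᵐ w, P w) → ∀ᵐ z, P (ψ p a (root s) z) :=
      fun a _ h => ae_sub_div (slope_ne_zero hp a _) _ h
    have hall := ae_all_iff.mpr fun a => hψ a (ih (sub s a))
    filter_upwards [hall, ae_im_ne_zero, hψ 1 ae_im_ne_zero, hψ 2 ae_im_ne_zero] with z hz h0 h1 h2 hzc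
    have hquart : ∀ a : Fin 4, HasLogIncrement (curveParam p s) z ((a : ℕ) / 4) (((a : ℕ) + 1) / 4)
        (segLog (ψ p a (root s) z) -
          2 * Real.pi * Complex.I * (index p n (sub s a) (ψ p a (root s) z) : ℂ)) := by
      intro a
      have hmaps : MapsTo (fun x : ℝ => 4 * x - (a : ℕ))
          (Icc ((a : ℕ) / 4 : ℝ) (((a : ℕ) + 1) / 4)) (Icc 0 1) :=
        fun x hx => ⟨by linarith [hx.1], by linarith [hx.2]⟩
      refine (hz a fun hc => hzc ?_).transport (slope_ne_zero hp a (root s)) (by fun_prop) hmaps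
        (by ring) (by ring) fun x hx => ?_
      · exact mem_iUnion.mpr ⟨a, _, hc, φ_ψ hp _ _ _⟩
      · rw [← φ_sub hp, ← curveParam_add_div_four hp hp' s a (hmaps hx)]
        congr 2
        ring
    have h := HasLogIncrement.quarters hquart
    rw [Finset.sum_sub_distrib, sum_segLog_ψ hp hp' _ h0 h1 h2, ← Finset.mul_sum] at h
    convert h using 1
    rw [index]
    push_cast
    ring

/-! ### Areas of the approximations -/

theorem volume_cover_le (hp : 1 / 4 < p) (n : ℕ) (s : Choices) :
    volume (cover p n s) ≤ ENNReal.ofReal (4 * p ^ 2) ^ n * volume (rhombus p) := by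
  induction n generalizing s with
  | zero => simp [cover]
  | succ n ih =>
    have him : ∀ a, volume (φ p a (root s) '' cover p n (sub s a)) ≤
        ENNReal.ofReal (p ^ 2) * (ENNReal.ofReal (4 * p ^ 2) ^ n * volume (rhombus p)) := by
      intro a
      rw [show φ p a (root s) = fun z => slope p a (root s) * z + offset p a (root s) from
        funext (φ_eq p a _), volume_image_affine (slope_ne_zero hp a _), norm_slope hp]
      gcongr
      exact ih _
    calc volume (cover p (n + 1) s)
        ≤ ∑ a : Fin 4, volume (φ p a (root s) '' cover p n (sub s a)) := measure_iUnion_fintype_le _ _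
      _ ≤ ∑ _a : Fin 4, ENNReal.ofReal (p ^ 2) *
          (ENNReal.ofReal (4 * p ^ 2) ^ n * volume (rhombus p)) := Finset.sum_le_sum fun a _ => him a
      _ = ENNReal.ofReal (4 * p ^ 2) ^ (n + 1) * volume (rhombus p) := by
        rw [Finset.sum_const, Finset.card_univ, Fintype.card_fin, nsmul_eq_mul, pow_succ',
          ENNReal.ofReal_mul (p := 4) (by norm_num)]
        simp only [Nat.cast_ofNat, ENNReal.ofReal_ofNat]
        ring

theorem tendsto_volume_cover (hp : 1 / 4 < p) (hp' : p ≤ 1 / 3) (s : Choices) :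
    Tendsto (fun n => volume (cover p n s)) atTop (𝓝 0) := by
  have hlt : ENNReal.ofReal (4 * p ^ 2) < 1 := by
    rw [ENNReal.ofReal_lt_one]
    nlinarith
  have h := ENNReal.Tendsto.mul_const (b := volume (rhombus p))
    (ENNReal.tendsto_pow_atTop_nhds_zero_of_lt_one hlt)
    (Or.inr (isCompact_rhombus hp hp').measure_lt_top.ne)
  rw [zero_mul] at h
  exact tendsto_of_tendsto_of_tendsto_of_le_of_le tendsto_const_nhds h (fun _ => zero_le)
    fun n => volume_cover_le hp n s

theorem curve_subset_cover (hp : 1 / 4 < p) (hp' : p ≤ 1 / 3) (n : ℕ) (s : Choices) :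
    curve p s ⊆ cover p n s := by
  induction n generalizing s with
  | zero => exact iUnion_subset fun u => limitSet_subset_rhombus hp hp' s u
  | succ n ih =>
    intro z hz
    obtain ⟨u, hu⟩ := mem_iUnion.mp hz
    obtain ⟨w, hw, rfl⟩ := exists_of_mem_limitSet hp hp' hu
    exact mem_iUnion.mpr ⟨u 0, w, ih _ (mem_iUnion.mpr ⟨_, hw⟩), rfl⟩

theorem bump_half_width_pos (hp' : p ≤ 1 / 3) : 0 < 1 / 2 - p := by
  linarith

open Classical in
theorem ite_bump_eq_indicator (b : Fin 2) (z : ℂ) :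
    ((if z ∈ bump p b then orient b else 0 : ℤ) : ℝ) =
      orient b * (bump p b).indicator (fun _ => (1 : ℝ)) z := by
  by_cases h : z ∈ bump p b <;> simp [h]

theorem index_succ_eq (n : ℕ) (s : Choices) : (fun z => (index p (n + 1) s z : ℝ)) = fun z =>
    orient (root s) * (bump p (root s)).indicator (fun _ => (1 : ℝ)) z +
      ∑ a, (index p n (sub s a) (ψ p a (root s) z) : ℝ) := by
  funext z
  rw [index, Int.cast_add, ite_bump_eq_indicator, Int.cast_sum]

theorem integrable_index (hp : 1 / 4 < p) (hp' : p ≤ 1 / 3) (n : ℕ) (s : Choices) :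
    Integrable fun z => (index p n s z : ℝ) := by
  induction n generalizing s with
  | zero => simp [index]
  | succ n ih =>
    rw [index_succ_eq]
    refine Integrable.add (Integrable.const_mul (integrable_tri (bump_half_width_pos hp')
      (div_ne_zero (tilt_ne_zero hp _) two_ne_zero)) _) (integrable_finsetSum _ fun a _ => ?_)
    exact integrable_comp_sub_div (slope_ne_zero hp a _) _ (ih _)

/-- The signed number of triangles of generation `k`. -/
def orientSum (k : ℕ) (s : Choices) : ℤ := ∑ j, orient (s k j)

theorem orientSum_zero (s : Choices) : orientSum 0 s = orient (root s) := by
  simp only [orientSum, root]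
  exact Fin.sum_univ_one _

theorem orientSum_succ (k : ℕ) (s : Choices) :
    orientSum (k + 1) s = ∑ a, orientSum k (sub s a) := by
  have h4 : 4 * 4 ^ k = 4 ^ (k + 1) := (pow_succ' 4 k).symm
  simp only [orientSum]
  rw [← Fintype.sum_prod_type', ← Equiv.sum_comp (finProdFinEquiv.trans (finCongr h4))]
  refine Finset.sum_congr rfl fun x _ => ?_
  simp only [sub]
  congr 2
  apply Fin.ext
  simp [finProdFinEquiv]
  ring

/-- The area of the triangle erected on the segment `[-1/2, 1/2]`. -/
noncomputable def bumpArea (p : ℝ) : ℝ := (1 / 2 - p) * (Real.sqrt (4 * p - 1) / 2)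

theorem integral_index (hp : 1 / 4 < p) (hp' : p ≤ 1 / 3) (n : ℕ) (s : Choices) :
    ∫ z, (index p n s z : ℝ) =
      bumpArea p * ∑ k ∈ Finset.range n, p ^ (2 * k) * (orientSum k s : ℝ) := by
  induction n generalizing s with
  | zero => simp [index]
  | succ n ih =>
    have hb : Integrable ((bump p (root s)).indicator fun _ => (1 : ℝ)) :=
      integrable_tri (bump_half_width_pos hp') (div_ne_zero (tilt_ne_zero hp (root s)) two_ne_zero)
    have hi : ∀ a, Integrable fun z => (index p n (sub s a) (ψ p a (root s) z) : ℝ) := fun a =>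
      integrable_comp_sub_div (slope_ne_zero hp a _) _ (integrable_index hp hp' n (sub s a))
    have hint : ∀ a, ∫ z, (index p n (sub s a) (ψ p a (root s) z) : ℝ) =
        p ^ 2 * (bumpArea p * ∑ k ∈ Finset.range n, p ^ (2 * k) * (orientSum k (sub s a) : ℝ)) := by
      intro a
      have h := integral_comp_sub_div (slope_ne_zero hp a (root s)) (offset p a (root s))
        fun z => (index p n (sub s a) z : ℝ)
      rwa [norm_slope hp, ih] at h
    rw [index_succ_eq, integral_add (Integrable.const_mul hb _)
      (integrable_finsetSum _ fun a _ => hi a), integral_const_mul,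
      integral_finsetSum _ fun a _ => hi a, Finset.sum_range_succ', orientSum_zero]
    have harea : ∫ z, (bump p (root s)).indicator (fun _ => (1 : ℝ)) z = bumpArea p := by
      rw [bump, integral_tri (bump_half_width_pos hp')
        (div_ne_zero (tilt_ne_zero hp (root s)) two_ne_zero), abs_div, abs_tilt, abs_two]
      rfl
    rw [harea]
    simp only [hint, orientSum_succ, Int.cast_sum]
    have hsum : ∑ a : Fin 4, ∑ k ∈ Finset.range n, p ^ (2 * k) * (orientSum k (sub s a) : ℝ) =
        ∑ k ∈ Finset.range n, p ^ (2 * k) * ∑ a : Fin 4, (orientSum k (sub s a) : ℝ) := by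
      rw [Finset.sum_comm]
      exact Finset.sum_congr rfl fun k _ => (Finset.mul_sum _ _ _).symm
    have hshift : ∑ k ∈ Finset.range n, p ^ (2 * (k + 1)) *
        ∑ a : Fin 4, (orientSum k (sub s a) : ℝ) =
        p ^ 2 * ∑ k ∈ Finset.range n, p ^ (2 * k) * ∑ a : Fin 4, (orientSum k (sub s a) : ℝ) := by
      rw [Finset.mul_sum]
      exact Finset.sum_congr rfl fun k _ => by ring
    rw [← Finset.mul_sum, ← Finset.mul_sum, hsum, hshift, mul_zero, pow_zero]
    ring

/-! ### The three sides of the snowflake -/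

/-- The linear part of `f₁`. -/
noncomputable def rot₁ : ℂ := -(1 / 2) * (1 + Real.sqrt 3 * Complex.I)

/-- The linear part of `f₂`. -/
noncomputable def rot₂ : ℂ := -(1 / 2) * (1 - Real.sqrt 3 * Complex.I)

/-- The inverse of `f₁`. -/
noncomputable def g₁ (z : ℂ) : ℂ := (z - (1 - Real.sqrt 3 * Complex.I) / 4) / rot₁

/-- The inverse of `f₂`. -/
noncomputable def g₂ (z : ℂ) : ℂ := (z - -(1 + Real.sqrt 3 * Complex.I) / 4) / rot₂

theorem sqrt_three_mul_self : Real.sqrt 3 * Real.sqrt 3 = 3 := Real.mul_self_sqrt (by norm_num)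

theorem norm_rot₁ : ‖rot₁‖ = 1 := by
  rw [Complex.norm_def, Real.sqrt_eq_one, Complex.normSq_apply]
  simp [rot₁]
  linarith [sqrt_three_mul_self]

theorem norm_rot₂ : ‖rot₂‖ = 1 := by
  rw [Complex.norm_def, Real.sqrt_eq_one, Complex.normSq_apply]
  simp [rot₂]
  linarith [sqrt_three_mul_self]

theorem rot₁_ne_zero : rot₁ ≠ 0 := norm_pos_iff.mp (by rw [norm_rot₁]; exact one_pos)

theorem rot₂_ne_zero : rot₂ ≠ 0 := norm_pos_iff.mp (by rw [norm_rot₂]; exact one_pos)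

theorem f₁_sub (w z : ℂ) : f₁ w - z = rot₁ * (w - g₁ z) := by
  rw [g₁, mul_sub, mul_div_cancel₀ _ rot₁_ne_zero, f₁, rot₁]
  ring

theorem f₂_sub (w z : ℂ) : f₂ w - z = rot₂ * (w - g₂ z) := by
  rw [g₂, mul_sub, mul_div_cancel₀ _ rot₂_ne_zero, f₂, rot₂]
  ring

theorem f₁_g₁ (z : ℂ) : f₁ (g₁ z) = z := by
  rw [← sub_eq_zero, f₁_sub, sub_self, mul_zero]

theorem f₂_g₂ (z : ℂ) : f₂ (g₂ z) = z := by
  rw [← sub_eq_zero, f₂_sub, sub_self, mul_zero]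

theorem g₁_f₁ (z : ℂ) : g₁ (f₁ z) = z := by
  have h := f₁_sub z (f₁ z)
  rw [sub_self, eq_comm, mul_eq_zero, or_iff_right rot₁_ne_zero, sub_eq_zero] at h
  exact h.symm

theorem g₂_f₂ (z : ℂ) : g₂ (f₂ z) = z := by
  have h := f₂_sub z (f₂ z)
  rw [sub_self, eq_comm, mul_eq_zero, or_iff_right rot₂_ne_zero, sub_eq_zero] at h
  exact h.symm

theorem f₁_neg_half : f₁ ((-1 / 2 : ℝ) : ℂ) = ((1 / 2 : ℝ) : ℂ) := by
  simp [f₁]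
  ring

theorem f₁_half : f₁ ((1 / 2 : ℝ) : ℂ) = -(Real.sqrt 3 / 2 * Complex.I) := by
  simp [f₁]
  ring

theorem f₂_neg_half : f₂ ((-1 / 2 : ℝ) : ℂ) = -(Real.sqrt 3 / 2 * Complex.I) := by
  simp [f₂]
  ring

theorem f₂_half : f₂ ((1 / 2 : ℝ) : ℂ) = ((-1 / 2 : ℝ) : ℂ) := by
  simp [f₂]
  ring

/-- In the coordinates `(re, √3 * im)` the rotations have rational coefficients. -/
theorem coords_g₁ (z : ℂ) :
    z.re = -(g₁ z).re / 2 + Real.sqrt 3 * (g₁ z).im / 2 + 1 / 4 ∧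
    Real.sqrt 3 * z.im = -(Real.sqrt 3 * (g₁ z).im) / 2 - 3 / 2 * (g₁ z).re - 3 / 4 := by
  have h3 := sqrt_three_mul_self
  have hre := congrArg Complex.re (f₁_g₁ z)
  have him := congrArg Complex.im (f₁_g₁ z)
  simp [f₁] at hre him
  constructor
  · rw [← hre]
    ring
  · rw [← him]
    linear_combination (-(g₁ z).re / 2 - 1 / 4) * h3

theorem coords_g₂ (z : ℂ) :
    z.re = -(g₂ z).re / 2 - Real.sqrt 3 * (g₂ z).im / 2 - 1 / 4 ∧
    Real.sqrt 3 * z.im = -(Real.sqrt 3 * (g₂ z).im) / 2 + 3 / 2 * (g₂ z).re - 3 / 4 := by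
  have h3 := sqrt_three_mul_self
  have hre := congrArg Complex.re (f₂_g₂ z)
  have him := congrArg Complex.im (f₂_g₂ z)
  simp [f₂] at hre him
  constructor
  · rw [← hre]
    ring
  · rw [← him]
    linear_combination ((g₂ z).re / 2 - 1 / 4) * h3

/-- The open equilateral triangle on which the snowflake is built. -/
noncomputable def core : Set ℂ := tri (1 / 2) (-(Real.sqrt 3 / 2))

theorem sqrt_three_pos : 0 < Real.sqrt 3 := Real.sqrt_pos.mpr (by norm_num)

theorem sqrt_three_mul_neg {x : ℝ} : Real.sqrt 3 * x < 0 ↔ x < 0 := by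
  rw [← neg_pos, ← mul_neg, mul_pos_iff_of_pos_left sqrt_three_pos, neg_pos]

theorem mem_core_iff (z : ℂ) : z ∈ core ↔ Real.sqrt 3 * z.im < 0 ∧
    Real.sqrt 3 * (g₁ z).im < 0 ∧ Real.sqrt 3 * (g₂ z).im < 0 := by
  have h3 := sqrt_three_mul_self
  have hs := sqrt_three_pos
  have h : z.im / (-(Real.sqrt 3 / 2)) = -(2 / 3) * (Real.sqrt 3 * z.im) := by
    field_simp
    linear_combination z.im * h3
  simp only [core, tri, mem_ofPred_eq, h]
  obtain ⟨a1, b1⟩ := coords_g₁ z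
  obtain ⟨a2, b2⟩ := coords_g₂ z
  generalize Real.sqrt 3 * z.im = y at *
  generalize Real.sqrt 3 * (g₁ z).im = y1 at *
  generalize Real.sqrt 3 * (g₂ z).im = y2 at *
  rw [← lt_sub_iff_add_lt, div_lt_iff₀ (by norm_num), abs_lt]
  constructor
  · rintro ⟨c1, c2, c3⟩
    refine ⟨?_, ?_, ?_⟩ <;> linarith
  · rintro ⟨c1, c2, c3⟩
    refine ⟨?_, ?_, ?_⟩ <;> linarith

/-- The rhombus of a side has half angles of at most 30 degrees at the corners of `core`. -/
theorem abs_add_abs_lt_of_mem_openRhombus (hp : 1 / 4 < p) (hp' : p ≤ 1 / 3) {z : ℂ}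
    (hz : z ∈ openRhombus p) : 2 * |z.re| + 2 * |Real.sqrt 3 * z.im| < 1 := by
  refine lt_of_le_of_lt ?_ ((mem_openRhombus_iff 0).mp hz)
  have hs := sqrt_pos_of_lt hp
  have hprod : Real.sqrt 3 * Real.sqrt (4 * p - 1) ≤ 1 := by
    rw [← Real.sqrt_mul (by norm_num)]
    exact Real.sqrt_le_one.mpr (by linarith)
  have : |Real.sqrt 3 * z.im| ≤ |z.im / tilt p 0| := by
    rw [abs_mul, abs_div, abs_tilt, abs_of_pos sqrt_three_pos, le_div_iff₀ hs]
    nlinarith [abs_nonneg z.im]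
  linarith

open Classical in
/-- The number of turns that the snowflake with indices of its sides truncated after `n` steps makes
around `z`. -/
noncomputable def wind (p : ℝ) (n : ℕ) (s t r : Choices) (z : ℂ) : ℤ :=
  (if z ∈ core then 1 else 0) + index p n s z + index p n t (g₁ z) + index p n r (g₂ z)

/-- The three rhombi are disjoint, and each meets `core` in its inner half, where the index of its
curve is `0` or `-1`. -/
theorem wind_range (hp : 1 / 4 < p) (hp' : p ≤ 1 / 3) (n : ℕ) (s t r : Choices) (z : ℂ) :
    wind p n s t r z = 0 ∨ wind p n s t r z = 1 := by
  obtain ⟨a1, b1⟩ := coords_g₁ z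
  obtain ⟨a2, b2⟩ := coords_g₂ z
  have hcore := mem_core_iff z
  obtain ⟨s0, s1, s2⟩ := index_range hp hp' n s z
  obtain ⟨t0, t1, t2⟩ := index_range hp hp' n t (g₁ z)
  obtain ⟨r0, r1, r2⟩ := index_range hp hp' n r (g₂ z)
  have hV : ∀ {w : ℂ}, w ∈ openRhombus p → _ := fun hw =>
    two_abs_add_two_abs_lt_iff.mp (abs_add_abs_lt_of_mem_openRhombus hp hp' hw)
  -- In each case the index of one side, and membership in the triangle, are governed by one sign.
  have finish : ∀ {w : ℂ} {i : ℤ}, (z ∈ core ↔ w.im < 0) → (0 ≤ w.im → i = 0 ∨ i = 1) →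
      (w.im ≤ 0 → i = 0 ∨ i = -1) → wind p n s t r z = (open Classical in if z ∈ core then 1 else 0) + i →
      wind p n s t r z = 0 ∨ wind p n s t r z = 1 := by
    intro w i h h1 h2 h3
    rw [h3]
    by_cases hw : w.im < 0
    · rw [if_pos (h.mpr hw)]
      rcases h2 hw.le with rfl | rfl <;> simp
    · rw [if_neg (mt h.mp hw)]
      rcases h1 (not_lt.mp hw) with rfl | rfl <;> simp
  by_cases hz : z ∈ openRhombus p
  · obtain ⟨c1, c2, c3, c4⟩ := hV hz
    have ht : g₁ z ∉ openRhombus p := by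
      intro h
      obtain ⟨d1, d2, d3, d4⟩ := hV h
      linarith
    have hr : g₂ z ∉ openRhombus p := by
      intro h
      obtain ⟨d1, d2, d3, d4⟩ := hV h
      linarith
    refine finish (w := z) ?_ s1 s2 (by rw [wind, t0 ht, r0 hr, add_zero, add_zero])
    rw [hcore, sqrt_three_mul_neg]
    refine ⟨fun h => h.1, fun h => ⟨h, ?_, ?_⟩⟩ <;> linarith
  · by_cases hz1 : g₁ z ∈ openRhombus p
    · obtain ⟨c1, c2, c3, c4⟩ := hV hz1
      have hr : g₂ z ∉ openRhombus p := by
        intro h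
        obtain ⟨d1, d2, d3, d4⟩ := hV h
        linarith
      refine finish (w := g₁ z) ?_ t1 t2 (by rw [wind, s0 hz, r0 hr, add_zero, add_zero])
      rw [hcore, ← sqrt_three_mul_neg (x := (g₁ z).im)]
      refine ⟨fun h => h.2.1, fun h => ⟨?_, h, ?_⟩⟩ <;> linarith
    · by_cases hz2 : g₂ z ∈ openRhombus p
      · obtain ⟨c1, c2, c3, c4⟩ := hV hz2
        refine finish (w := g₂ z) ?_ r1 r2 (by rw [wind, s0 hz, t0 hz1, add_zero, add_zero])
        rw [hcore, ← sqrt_three_mul_neg (x := (g₂ z).im)]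
        refine ⟨fun h => h.2.2, fun h => ⟨?_, ?_, h⟩⟩ <;> linarith
      · rw [wind, s0 hz, t0 hz1, r0 hz2]
        split_ifs <;> simp

open Classical in
theorem segLog_add_segLog_add_segLog {z : ℂ} (h0 : z.im ≠ 0) (h1 : (g₁ z).im ≠ 0)
    (h2 : (g₂ z).im ≠ 0) : segLog z + segLog (g₁ z) + segLog (g₂ z) =
      -(2 * Real.pi * Complex.I * ((if z ∈ core then 1 else 0 : ℤ) : ℂ)) := by
  have hlt : (-1 / 2 : ℝ) < 1 / 2 := by norm_num
  have e := log_add_log_add_log (im_div_real_ne hlt h0) (im_div_real_ne hlt h1)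
    (im_div_real_ne hlt h2) (by
    have hP := real_sub_ne (-1 / 2) h0
    have hQ := real_sub_ne (1 / 2) h0
    have hA : (-(Real.sqrt 3 / 2 * Complex.I) - z : ℂ) ≠ 0 := by
      rw [← f₁_half, f₁_sub]
      exact mul_ne_zero rot₁_ne_zero (real_sub_ne (1 / 2) h1)
    rw [← mul_div_mul_left (_ - g₁ z) _ rot₁_ne_zero, ← mul_div_mul_left (_ - g₂ z) _ rot₂_ne_zero,
      ← f₁_sub, ← f₁_sub, ← f₂_sub, ← f₂_sub, f₁_half, f₁_neg_half, f₂_half, f₂_neg_half]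
    generalize (-(Real.sqrt 3 / 2 * Complex.I) - z : ℂ) = A at hA ⊢
    generalize (((-1 / 2 : ℝ) : ℂ) - z) = P at hP ⊢
    generalize (((1 / 2 : ℝ) : ℂ) - z) = Q at hQ ⊢
    field_simp)
  simp only [im_div_real_pos hlt h0, im_div_real_pos hlt h1, im_div_real_pos hlt h2,
    im_div_real_neg hlt h0, im_div_real_neg hlt h1, im_div_real_neg hlt h2] at e
  have hcore := mem_core_iff z
  simp only [sqrt_three_mul_neg] at hcore
  have hnot : ¬(0 < z.im ∧ 0 < (g₁ z).im ∧ 0 < (g₂ z).im) := by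
    rintro ⟨c0, c1, c2⟩
    have d0 := mul_pos sqrt_three_pos c0
    have d1 := mul_pos sqrt_three_pos c1
    have d2 := mul_pos sqrt_three_pos c2
    obtain ⟨a1, b1⟩ := coords_g₁ z
    obtain ⟨a2, b2⟩ := coords_g₂ z
    linarith
  rw [if_neg hnot, zero_sub] at e
  simp only [segLog]
  rw [e]
  by_cases h : z ∈ core
  · rw [if_pos h, if_pos (hcore.mp h)]
    push_cast
    ring
  · rw [if_neg h, if_neg (mt hcore.mpr h)]
    simp

theorem ae_g₁ {P : ℂ → Prop} (h : ∀ᵐ w, P w) : ∀ᵐ z, P (g₁ z) := ae_sub_div rot₁_ne_zero _ h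

theorem ae_g₂ {P : ℂ → Prop} (h : ∀ᵐ w, P w) : ∀ᵐ z, P (g₂ z) := ae_sub_div rot₂_ne_zero _ h

theorem ae_hasWindingNumber (hp : 1 / 4 < p) (hp' : p ≤ 1 / 3) (n : ℕ) (s t r : Choices) :
    ∀ᵐ z : ℂ, z ∉ cover p n s → g₁ z ∉ cover p n t → g₂ z ∉ cover p n r →
      HasWindingNumber (snowflakeParam p s t r) z (wind p n s t r z) := by
  filter_upwards [ae_hasLogIncrement hp hp' n s, ae_g₁ (ae_hasLogIncrement hp hp' n t),
    ae_g₂ (ae_hasLogIncrement hp hp' n r), ae_im_ne_zero, ae_g₁ ae_im_ne_zero, ae_g₂ ae_im_ne_zero]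
    with z hs ht hr h0 h1 h2 cs ct cr
  have js := (hs cs).transport_neg (γ' := snowflakeParam p s t r) (z' := z) (a := 0) (b := 1 / 3)
    (f := fun x => 1 - 3 * x) one_ne_zero (by fun_prop)
    (fun x hx => ⟨by linarith [hx.2], by linarith [hx.1]⟩) (by norm_num) (by norm_num) (by
      intro x hx
      rw [one_mul, snowflakeParam]
      split_ifs with c1 c2
      · rfl
      · have : x = 1 / 3 := le_antisymm hx.2 (not_lt.mp c1)
        subst this
        norm_num
        rw [curveParam_zero hp hp', curveParam_one hp hp', f₂_half]
      · linarith [hx.2])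
  have jr := (hr cr).transport_neg (γ' := snowflakeParam p s t r) (z' := z) (a := 1 / 3) (b := 2 / 3)
    (f := fun x => 2 - 3 * x) rot₂_ne_zero (by fun_prop)
    (fun x hx => ⟨by linarith [hx.2], by linarith [hx.1]⟩) (by norm_num) (by norm_num) (by
      intro x hx
      rw [← f₂_sub, snowflakeParam]
      split_ifs with c1 c2
      · linarith [hx.1]
      · rfl
      · have : x = 2 / 3 := le_antisymm hx.2 (not_lt.mp c2)
        subst this
        norm_num
        rw [curveParam_zero hp hp', curveParam_one hp hp', f₁_half, f₂_neg_half])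
  have jt := (ht ct).transport_neg (γ' := snowflakeParam p s t r) (z' := z) (a := 2 / 3) (b := 1)
    (f := fun x => 3 - 3 * x) rot₁_ne_zero (by fun_prop)
    (fun x hx => ⟨by linarith [hx.2], by linarith [hx.1]⟩) (by norm_num) (by norm_num) (by
      intro x hx
      rw [← f₁_sub, snowflakeParam, if_neg (by linarith [hx.1]), if_neg (by linarith [hx.1])])
  have h := (js.trans (by norm_num) (by norm_num) jr).trans (by norm_num) (by norm_num) jt
  have e := segLog_add_segLog_add_segLog h0 h1 h2
  change HasLogIncrement (snowflakeParam p s t r) z 0 1 _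
  convert h using 1
  rw [wind]
  push_cast at e ⊢
  linear_combination e

/-! ### The enclosed area -/

theorem integrable_wind (hp : 1 / 4 < p) (hp' : p ≤ 1 / 3) (n : ℕ) (s t r : Choices) :
    Integrable (fun z => (wind p n s t r z : ℝ)) ∧ ∫ z, (wind p n s t r z : ℝ) =
      Real.sqrt 3 / 4 + bumpArea p * ∑ k ∈ Finset.range n,
        p ^ (2 * k) * ((orientSum k s : ℝ) + orientSum k t + orientSum k r) := by
  have hne : -(Real.sqrt 3 / 2) ≠ 0 := by simp
  have hc : Integrable (core.indicator fun _ => (1 : ℝ)) := integrable_tri (by norm_num) hne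
  have hs := integrable_index hp hp' n s
  have ht : Integrable fun z => (index p n t (g₁ z) : ℝ) :=
    integrable_comp_sub_div rot₁_ne_zero _ (integrable_index hp hp' n t)
  have hr : Integrable fun z => (index p n r (g₂ z) : ℝ) :=
    integrable_comp_sub_div rot₂_ne_zero _ (integrable_index hp hp' n r)
  have hit : ∫ z, (index p n t (g₁ z) : ℝ) = ∫ z, (index p n t z : ℝ) := by
    have h := integral_comp_sub_div rot₁_ne_zero ((1 - Real.sqrt 3 * Complex.I) / 4)
      fun z => (index p n t z : ℝ)
    rwa [norm_rot₁, one_pow, one_mul] at h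
  have hir : ∫ z, (index p n r (g₂ z) : ℝ) = ∫ z, (index p n r z : ℝ) := by
    have h := integral_comp_sub_div rot₂_ne_zero (-(1 + Real.sqrt 3 * Complex.I) / 4)
      fun z => (index p n r z : ℝ)
    rwa [norm_rot₂, one_pow, one_mul] at h
  have hic : ∫ z, core.indicator (fun _ => (1 : ℝ)) z = Real.sqrt 3 / 4 := by
    rw [core, integral_tri (by norm_num) hne, abs_neg, abs_of_pos (by positivity)]
    ring
  have heq : (fun z => (wind p n s t r z : ℝ)) = fun z => core.indicator (fun _ => (1 : ℝ)) z +
      index p n s z + index p n t (g₁ z) + index p n r (g₂ z) := by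
    funext z
    by_cases h : z ∈ core <;> simp [wind, h]
  rw [heq]
  have hcs : Integrable fun z => core.indicator (fun _ => (1 : ℝ)) z + index p n s z := hc.add hs
  have hcst : Integrable fun z => core.indicator (fun _ => (1 : ℝ)) z + index p n s z +
    index p n t (g₁ z) := hcs.add ht
  refine ⟨hcst.add hr, ?_⟩
  rw [integral_add hcst hr, integral_add hcs ht, integral_add hc hs, hic, hit,
    hir, integral_index hp hp', integral_index hp hp', integral_index hp hp']
  simp only [mul_add, Finset.sum_add_distrib]
  ring

theorem volume_wind_eq_one (hp : 1 / 4 < p) (hp' : p ≤ 1 / 3) (n : ℕ) (s t r : Choices) :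
    volume {z | wind p n s t r z = 1} = ENNReal.ofReal (∫ z, (wind p n s t r z : ℝ)) := by
  have hint := (integrable_wind hp hp' n s t r).1
  have hset : {z | wind p n s t r z = 1} = (fun z => (wind p n s t r z : ℝ)) ⁻¹' {1} := by
    ext z
    simp
  have hmeas : NullMeasurableSet {z | wind p n s t r z = 1} := by
    rw [hset]
    exact hint.aemeasurable.nullMeasurableSet_preimage (measurableSet_singleton 1)
  rw [ofReal_integral_eq_lintegral_ofReal hint, ← lintegral_indicator_one₀ hmeas]
  · refine lintegral_congr fun z => ?_
    rcases wind_range hp hp' n s t r z with h | h <;> simp [indicator, h]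
  · refine Eventually.of_forall fun z => ?_
    rcases wind_range hp hp' n s t r z with h | h <;> simp [h]

/-- The points not yet separated from the snowflake by the rhombi of generation `n`. -/
def snowflakeCover (p : ℝ) (n : ℕ) (s t r : Choices) : Set ℂ :=
  cover p n s ∪ g₁ ⁻¹' cover p n t ∪ g₂ ⁻¹' cover p n r

theorem snowflake_subset_cover (hp : 1 / 4 < p) (hp' : p ≤ 1 / 3) (n : ℕ) (s t r : Choices) :
    snowflake p s t r ⊆ snowflakeCover p n s t r := by
  refine union_subset_union (union_subset_union (curve_subset_cover hp hp' n s) ?_) ?_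
  · rintro _ ⟨z, hz, rfl⟩
    rw [mem_preimage, g₁_f₁]
    exact curve_subset_cover hp hp' n t hz
  · rintro _ ⟨z, hz, rfl⟩
    rw [mem_preimage, g₂_f₂]
    exact curve_subset_cover hp hp' n r hz

theorem tendsto_volume_snowflakeCover (hp : 1 / 4 < p) (hp' : p ≤ 1 / 3) (s t r : Choices) :
    Tendsto (fun n => volume (snowflakeCover p n s t r)) atTop (𝓝 0) := by
  have h1 : ∀ S : Set ℂ, volume (g₁ ⁻¹' S) = volume S := by
    intro S
    have h := (measurableEmbedding_sub_div rot₁_ne_zero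
      ((1 - Real.sqrt 3 * Complex.I) / 4)).map_apply volume S
    rw [map_sub_div_volume rot₁_ne_zero, norm_rot₁, one_pow, ENNReal.ofReal_one, one_smul] at h
    exact h.symm
  have h2 : ∀ S : Set ℂ, volume (g₂ ⁻¹' S) = volume S := by
    intro S
    have h := (measurableEmbedding_sub_div rot₂_ne_zero
      (-(1 + Real.sqrt 3 * Complex.I) / 4)).map_apply volume S
    rw [map_sub_div_volume rot₂_ne_zero, norm_rot₂, one_pow, ENNReal.ofReal_one, one_smul] at h
    exact h.symm
  have hsum := ((tendsto_volume_cover hp hp' s).add (tendsto_volume_cover hp hp' t)).add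
    (tendsto_volume_cover hp hp' r)
  rw [add_zero, add_zero] at hsum
  refine tendsto_of_tendsto_of_tendsto_of_le_of_le tendsto_const_nhds hsum (fun _ => zero_le)
    fun n => ?_
  refine (measure_union_le _ _).trans (add_le_add ((measure_union_le _ _).trans ?_) (h2 _).le)
  rw [h1]

theorem ae_mem_enclosedRegion_iff (hp : 1 / 4 < p) (hp' : p ≤ 1 / 3) (n : ℕ) (s t r : Choices) :
    ∀ᵐ z : ℂ, z ∉ snowflakeCover p n s t r →
      (z ∈ enclosedRegion p s t r ↔ wind p n s t r z = 1) := by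
  filter_upwards [ae_hasWindingNumber hp hp' n s t r] with z hz hc
  have hc' := hc
  simp only [snowflakeCover, mem_union, not_or, mem_preimage] at hc'
  have hw := hz hc'.1.1 hc'.1.2 hc'.2
  refine ⟨fun h => hw.unique h.2, fun h => ⟨fun hs => hc (snowflake_subset_cover hp hp' n s t r hs),
    ?_⟩⟩
  rwa [h] at hw

/-- The enclosed area is the limit of the areas enclosed by the polygons approximating the
snowflake. -/
theorem enclosedArea_eq (hp : 1 / 4 < p) (hp' : p ≤ 1 / 3) (s t r : Choices) {A : ℝ}
    (h : Tendsto (fun n => Real.sqrt 3 / 4 + bumpArea p * ∑ k ∈ Finset.range n,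
      p ^ (2 * k) * ((orientSum k s : ℝ) + orientSum k t + orientSum k r)) atTop (𝓝 A)) :
    enclosedArea p s t r = ENNReal.ofReal A := by
  have hA : Tendsto (fun n => volume {z | wind p n s t r z = 1}) atTop (𝓝 (ENNReal.ofReal A)) := by
    simp only [volume_wind_eq_one hp hp', (integrable_wind hp hp' _ s t r).2]
    exact (ENNReal.continuous_ofReal.tendsto A).comp h
  have hQ := tendsto_volume_snowflakeCover hp hp' s t r
  have hae := fun n => ae_mem_enclosedRegion_iff hp hp' n s t r
  apply le_antisymm
  · have hlim := hA.add hQ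
    rw [add_zero] at hlim
    refine ge_of_tendsto' hlim fun n => ?_
    refine (measure_mono_ae ?_).trans (measure_union_le _ _)
    filter_upwards [hae n] with z hz hE
    by_cases hc : z ∈ snowflakeCover p n s t r
    · exact Or.inr hc
    · exact Or.inl ((hz hc).mp hE)
  · have hlim := (tendsto_const_nhds (x := enclosedArea p s t r)).add hQ
    rw [add_zero] at hlim
    refine le_of_tendsto_of_tendsto' hA hlim fun n => ?_
    refine (measure_mono_ae ?_).trans (measure_union_le _ _)
    filter_upwards [hae n] with z hz hE
    by_cases hc : z ∈ snowflakeCover p n s t r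
    · exact Or.inr hc
    · exact Or.inl ((hz hc).mpr hE)

/-! ### Attaining every area -/

/-- Choices with `m k` downward triangles in generation `k`. -/
def countChoices (m : ℕ → ℕ) : Choices := fun k j => if j.val < m k then 1 else 0

theorem orientSum_countChoices {m : ℕ → ℕ} {k : ℕ} (h : m k ≤ 4 ^ k) :
    orientSum k (countChoices m) = 4 ^ k - 2 * m k := by
  have h1 : orientSum k (countChoices m) =
      ∑ j ∈ Finset.range (4 ^ k), (1 - 2 * (if j < m k then 1 else 0 : ℤ)) := by
    rw [← Fin.sum_univ_eq_sum_range fun j => (1 - 2 * (if j < m k then 1 else 0 : ℤ))]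
    refine Finset.sum_congr rfl fun j _ => ?_
    simp only [countChoices]
    split_ifs <;> simp [orient]
  have h2 : (Finset.range (4 ^ k)).filter (fun j => j < m k) = Finset.range (m k) := by
    ext j
    simp only [Finset.mem_filter, Finset.mem_range]
    omega
  rw [h1, Finset.sum_sub_distrib, ← Finset.mul_sum, ← Finset.sum_filter, h2]
  simp

theorem orientSum_const (b : Fin 2) (k : ℕ) :
    orientSum k (constChoices b) = 4 ^ k * orient b := by
  simp [orientSum, constChoices]

/-- Greedy expansion. Since `p ≥ 1/4`, a single triangle of generation `k` is at most as large as
all later triangles on the three sides together, so the remainder never outgrows them. -/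
theorem exists_greedy (hp : 1 / 4 < p) (hp' : p ≤ 1 / 3) {v : ℝ}
    (hv : v ∈ Icc 0 (3 / (1 - 4 * p ^ 2))) : ∃ m : ℕ → ℕ, (∀ k, m k ≤ 3 * 4 ^ k) ∧
      Tendsto (fun n => ∑ k ∈ Finset.range n, p ^ (2 * k) * (m k : ℝ)) atTop (𝓝 v) := by
  have hp0 : 0 < p := by linarith
  have hq : 0 < 1 - 4 * p ^ 2 := by nlinarith
  set R : ℕ → ℝ := fun n => 3 * (4 * p ^ 2) ^ n / (1 - 4 * p ^ 2) with hR
  have hRrec : ∀ n, R n = 3 * 4 ^ n * p ^ (2 * n) + R (n + 1) := by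
    intro n
    simp only [hR]
    rw [mul_pow, mul_pow, ← pow_mul, ← pow_mul]
    field_simp
    ring
  have hRc : ∀ n, p ^ (2 * n) ≤ R (n + 1) := by
    intro n
    have h1 : (1 : ℝ) ≤ 4 ^ n := one_le_pow₀ (by norm_num)
    have h2 : 0 < p ^ (2 * n) := by positivity
    have h3 : R (n + 1) = p ^ (2 * n) * (4 ^ n * (12 * p ^ 2 / (1 - 4 * p ^ 2))) := by
      simp only [hR]
      rw [mul_pow, ← pow_mul]
      field_simp
      ring
    rw [h3]
    have h4 : 1 ≤ 12 * p ^ 2 / (1 - 4 * p ^ 2) := by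
      rw [le_div_iff₀ hq]
      nlinarith
    exact le_mul_of_one_le_right h2.le (one_le_mul_of_one_le_of_one_le h1 h4)
  have step : ∀ (n : ℕ) (x : ℝ), ∃ m : ℕ, x ∈ Icc 0 (R n) →
      m ≤ 3 * 4 ^ n ∧ x - p ^ (2 * n) * m ∈ Icc 0 (R (n + 1)) := by
    intro n x
    have hc : 0 < p ^ (2 * n) := by positivity
    by_cases hx : x ∈ Icc 0 (R n)
    · by_cases hbig : 3 * 4 ^ n * p ^ (2 * n) ≤ x
      · refine ⟨3 * 4 ^ n, fun _ => ⟨le_rfl, ?_, ?_⟩⟩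
        · push_cast
          linarith
        · push_cast
          linarith [hRrec n, hx.2]
      · refine ⟨⌊x / p ^ (2 * n)⌋₊, fun _ => ⟨?_, ?_, ?_⟩⟩
        · refine Nat.floor_le_of_le ?_
          rw [div_le_iff₀ hc]
          push_cast
          linarith
        · have := Nat.floor_le (div_nonneg hx.1 hc.le)
          rw [le_div_iff₀ hc] at this
          linarith
        · have := Nat.lt_floor_add_one (x / p ^ (2 * n))
          rw [div_lt_iff₀ hc] at this
          linarith [hRc n]
    · exact ⟨0, fun h => absurd h hx⟩
  choose f hf using step
  let rem : ℕ → ℝ := fun n => Nat.rec v (fun k x => x - p ^ (2 * k) * f k x) n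
  have hrem : ∀ n, rem n ∈ Icc 0 (R n) := by
    intro n
    induction n with
    | zero => simpa [rem, hR] using hv
    | succ n ih => exact (hf n (rem n) ih).2
  have hsum : ∀ n, ∑ k ∈ Finset.range n, p ^ (2 * k) * (f k (rem k) : ℝ) = v - rem n := by
    intro n
    induction n with
    | zero => simp [rem]
    | succ n ih =>
      have : rem (n + 1) = rem n - p ^ (2 * n) * f n (rem n) := rfl
      rw [Finset.sum_range_succ, ih, this]
      ring
  refine ⟨fun k => f k (rem k), fun k => (hf k _ (hrem k)).1, ?_⟩
  simp only [hsum]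
  have hR0 : Tendsto R atTop (𝓝 0) := by
    have h := ((tendsto_pow_atTop_nhds_zero_of_lt_one (r := 4 * p ^ 2) (by positivity)
      (by linarith)).const_mul 3).div_const (1 - 4 * p ^ 2)
    simpa [hR] using h
  have := tendsto_of_tendsto_of_tendsto_of_le_of_le tendsto_const_nhds hR0 (fun n => (hrem n).1)
    fun n => (hrem n).2
  simpa using this.const_sub v

theorem tendsto_sum_const (hp : 1 / 4 < p) (hp' : p ≤ 1 / 3) (c : ℝ) :
    Tendsto (fun n => ∑ k ∈ Finset.range n, p ^ (2 * k) * (4 ^ k * c)) atTop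
      (𝓝 (c / (1 - 4 * p ^ 2))) := by
  have h := ((hasSum_geometric_of_lt_one (r := 4 * p ^ 2) (by positivity)
    (by nlinarith)).tendsto_sum_nat).const_mul c
  rw [← div_eq_mul_inv] at h
  refine h.congr fun n => ?_
  rw [Finset.mul_sum]
  refine Finset.sum_congr rfl fun k _ => ?_
  rw [mul_pow, ← pow_mul]
  ring

theorem bumpArea_div (hp' : p ≤ 1 / 3) (hp : 1 / 4 < p) : bumpArea p * (3 / (1 - 4 * p ^ 2)) =
    3 / 4 * (Real.sqrt (4 * p - 1) / (1 + 2 * p)) := by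
  have h1 : (1 - 2 * p) ≠ 0 := by linarith
  have h2 : (1 + 2 * p) ≠ 0 := by linarith
  rw [show 1 - 4 * p ^ 2 = (1 - 2 * p) * (1 + 2 * p) by ring, bumpArea]
  field_simp
  ring

theorem enclosedArea_const (hp : 1 / 4 < p) (hp' : p ≤ 1 / 3) (b : Fin 2) :
    enclosedArea p (constChoices b) (constChoices b) (constChoices b) =
      ENNReal.ofReal (Real.sqrt 3 / 4 +
        orient b * (3 / 4 * (Real.sqrt (4 * p - 1) / (1 + 2 * p)))) := by
  apply enclosedArea_eq hp hp'
  have h := ((tendsto_sum_const hp hp' (3 * orient b)).const_mul (bumpArea p)).const_add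
    (Real.sqrt 3 / 4)
  convert h using 2
  · congr 2
    refine Finset.sum_congr rfl fun k _ => ?_
    rw [orientSum_const]
    push_cast
    ring
  · rw [← bumpArea_div hp' hp]
    ring

end Koch

theorem theorem4p1 (p : ℝ) (hp : 1 / 4 < p) (hp' : p ≤ 1 / 3) :
    Koch.antiSnowflakeArea p =
      ENNReal.ofReal (Real.sqrt 3 / 4 - 3 / 4 * (Real.sqrt (4 * p - 1) / (1 + 2 * p))) ∧
    Koch.snowflakeArea p =
      ENNReal.ofReal (Real.sqrt 3 / 4 + 3 / 4 * (Real.sqrt (4 * p - 1) / (1 + 2 * p))) ∧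
    ∀ y ∈ Set.Icc (Koch.antiSnowflakeArea p) (Koch.snowflakeArea p),
      ∃ s t r : Koch.Choices, Koch.enclosedArea p s t r = y := by
  have hx : Koch.antiSnowflakeArea p =
      ENNReal.ofReal (Real.sqrt 3 / 4 - 3 / 4 * (Real.sqrt (4 * p - 1) / (1 + 2 * p))) := by
    rw [Koch.antiSnowflakeArea, Koch.enclosedArea_const hp hp', Koch.orient_one]
    congr 1
    push_cast
    ring
  have hy : Koch.snowflakeArea p =
      ENNReal.ofReal (Real.sqrt 3 / 4 + 3 / 4 * (Real.sqrt (4 * p - 1) / (1 + 2 * p))) := by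
    rw [Koch.snowflakeArea, Koch.enclosedArea_const hp hp', Koch.orient_zero]
    congr 1
    push_cast
    ring
  refine ⟨hx, hy, fun y hmem => ?_⟩
  rw [hx, hy, ← Koch.bumpArea_div hp' hp] at hmem
  have hσ := Koch.sqrt_pos_of_lt hp
  have hbump : 0 < Koch.bumpArea p := mul_pos (by linarith) (by linarith)
  have hq : 0 < 1 - 4 * p ^ 2 := by nlinarith
  have hytop : y ≠ ⊤ := ne_top_of_le_ne_top ENNReal.ofReal_ne_top hmem.2
  have hlow := (ENNReal.ofReal_le_iff_le_toReal hytop).mp hmem.1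
  have hhigh := ENNReal.toReal_le_of_le_ofReal (by positivity) hmem.2
  -- `v` is the total size of the triangles that have to be turned downwards, in units of the largest.
  obtain ⟨m, hm, hlim⟩ := Koch.exists_greedy hp hp'
    (v := (Real.sqrt 3 / 4 + Koch.bumpArea p * (3 / (1 - 4 * p ^ 2)) - y.toReal) /
      (2 * Koch.bumpArea p)) (by
      constructor
      · exact div_nonneg (by linarith) (by linarith)
      · rw [div_le_iff₀ (by linarith)]
        linarith)
  refine ⟨Koch.countChoices fun k => min (m k) (4 ^ k),
    Koch.countChoices fun k => min (m k - 4 ^ k) (4 ^ k),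
    Koch.countChoices fun k => m k - 2 * 4 ^ k, ?_⟩
  rw [← ENNReal.ofReal_toReal hytop]
  apply Koch.enclosedArea_eq hp hp'
  have h := (((Koch.tendsto_sum_const hp hp' 3).sub (hlim.const_mul 2)).const_mul
    (Koch.bumpArea p)).const_add (Real.sqrt 3 / 4)
  convert h using 2
  · rw [Finset.mul_sum _ _ (2 : ℝ), ← Finset.sum_sub_distrib]
    congr 2
    refine Finset.sum_congr rfl fun k _ => ?_
    rw [Koch.orientSum_countChoices (min_le_right _ _),
      Koch.orientSum_countChoices (min_le_right _ _),
      Koch.orientSum_countChoices (by have := hm k; omega)]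
    have hsplit : min (m k) (4 ^ k) + min (m k - 4 ^ k) (4 ^ k) + (m k - 2 * 4 ^ k) = m k := by
      omega
    have hsplit' : ((min (m k) (4 ^ k) : ℕ) : ℝ) + ((min (m k - 4 ^ k) (4 ^ k) : ℕ) : ℝ) +
        ((m k - 2 * 4 ^ k : ℕ) : ℝ) = m k := by
      exact_mod_cast hsplit
    push_cast only [Int.cast_sub, Int.cast_mul, Int.cast_pow, Int.cast_ofNat, Int.cast_natCast]
    linear_combination (-2 * p ^ (2 * k)) * hsplit'
  · field_simp
    ring
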